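/- Let $N\ge 1$ be an integer, $\alpha\in(0,N)$ and $p\in(1,\infty)$, and let $I_\alpha:\mathbb R^N\to\mathbb R$ be the Riesz potential $$I_\alpha(x)=\frac{\Gamma(\frac{N-\alpha}{2})}{\Gamma(\frac{\alpha}{2})\,\pi^{N/2}\,2^{\alpha}\,|x|^{N-\alpha}} .$$ Let $u\in W^{1,2}(\mathbb R^N)\cap L^{\frac{2Np}{N+\alpha}}(\mathbb R^N)$ be a real-valued weak solution of the Choquard equation $$-\Delta u+u=(I_\alpha*|u|^p)\,|u|^{p-2}u\quad\text{in }\mathbb R^N,$$ that is, $\int_{\mathbb R^N}\nabla u\cdot\nabla\varphi+\int_{\mathbb R^N}u\varphi=\int_{\mathbb R^N}(I_\alpha*|u|^p)|u|^{p-2}u\,\varphi$ for every $\varphi\in C_c^\infty(\mathbb R^N)$. Assume moreover that $u\in W^{2,2}_{\mathrm{loc}}(\mathbb R^N)\cap W^{1,\frac{2Np}{N+\alpha}}(\mathbb R^N)$. Then $|\nabla u|^2$, $|u|^2$ and $(I_\alpha*|u|^p)|u|^p$ are integrable on $\mathbb R^N$ (the integral defining $I_\alpha*|u|^p$ being absolutely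 convergent almost everywhere), and $$\frac{N-2}{2}\int_{\mathbb R^N}|\nabla u|^2+\frac N2\int_{\mathbb R^N}|u|^2=\frac{N+\alpha}{2p}\int_{\mathbb R^N}(I_\alpha*|u|^p)|u|^p .$$ -/

import Mathlib

open MeasureTheory
open scoped ContDiff ENNReal

noncomputable section

/-- The integrable-on-compacts function `v` is the weak (distributional) `i`-th partial derivative
of `u` on `ℝ^N`: `∫ u ∂ᵢφ = - ∫ v φ` for all `φ ∈ C_c^∞(ℝ^N)`. -/
def HasWeakPartial {N : ℕ} (i : Fin N) (u v : EuclideanSpace ℝ (Fin N) → ℝ) : Prop :=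
  LocallyIntegrable u volume ∧ LocallyIntegrable v volume ∧
    ∀ φ : EuclideanSpace ℝ (Fin N) → ℝ, ContDiff ℝ ∞ φ → HasCompactSupport φ →
      ∫ x, u x * fderiv ℝ φ x (EuclideanSpace.single i 1) = - ∫ x, v x * φ x

/-- `g` is the weak gradient of `u` on `ℝ^N`. -/
def HasWeakGradient {N : ℕ} (u : EuclideanSpace ℝ (Fin N) → ℝ)
    (g : EuclideanSpace ℝ (Fin N) → EuclideanSpace ℝ (Fin N)) : Prop :=
  ∀ i : Fin N, HasWeakPartial i u (fun x => g x i)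

/-- `u ∈ L^q_loc(ℝ^N)`. -/
def MemLpLoc {N : ℕ} (q : ℝ≥0∞) (u : EuclideanSpace ℝ (Fin N) → ℝ) : Prop :=
  ∀ K : Set (EuclideanSpace ℝ (Fin N)), IsCompact K → MemLp u q (volume.restrict K)

/-- `u ∈ W^{k,q}(ℝ^N)`: all weak derivatives of `u` of order at most `k` exist and are in `L^q`. -/
def MemW {N : ℕ} (q : ℝ≥0∞) : ℕ → (EuclideanSpace ℝ (Fin N) → ℝ) → Prop
  | 0, u => MemLp u q volume
  | k + 1, u => MemLp u q volume ∧ ∀ i : Fin N, ∃ v, HasWeakPartial i u v ∧ MemW q k v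

/-- `u ∈ W^{k,q}_loc(ℝ^N)`: all weak derivatives of `u` of order at most `k` exist and are in
`L^q_loc`. -/
def MemWLoc {N : ℕ} (q : ℝ≥0∞) : ℕ → (EuclideanSpace ℝ (Fin N) → ℝ) → Prop
  | 0, u => MemLpLoc q u
  | k + 1, u => MemLpLoc q u ∧ ∀ i : Fin N, ∃ v, HasWeakPartial i u v ∧ MemWLoc q k v

/-- The Riesz kernel `I_α(x) = Γ((N-α)/2) / (Γ(α/2) π^{N/2} 2^α |x|^{N-α})` on `ℝ^N`. -/
def rieszKernel (N : ℕ) (α : ℝ) (x : EuclideanSpace ℝ (Fin N)) : ℝ :=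
  Real.Gamma (((N : ℝ) - α) / 2) /
    (Real.Gamma (α / 2) * Real.pi ^ ((N : ℝ) / 2) * (2 : ℝ) ^ α * ‖x‖ ^ ((N : ℝ) - α))

/-- The Riesz potential `I_α * |u|^p`. -/
def rieszPotential {N : ℕ} (α p : ℝ) (u : EuclideanSpace ℝ (Fin N) → ℝ) :
    EuclideanSpace ℝ (Fin N) → ℝ :=
  convolution (rieszKernel N α) (fun y => |u y| ^ p) (ContinuousLinearMap.lsmul ℝ ℝ) volume

/-- `u` is a weak solution of `-Δu + u = (I_α * |u|^p) |u|^{p-2} u` in `ℝ^N`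
(tested against `C_c^∞(ℝ^N)`). -/
def IsWeakChoquardSolution {N : ℕ} (α p : ℝ) (u : EuclideanSpace ℝ (Fin N) → ℝ) : Prop :=
  ∃ g, HasWeakGradient u g ∧
    ∀ φ : EuclideanSpace ℝ (Fin N) → ℝ, ContDiff ℝ ∞ φ → HasCompactSupport φ →
      (∫ x, inner ℝ (g x) (gradient φ x)) + ∫ x, u x * φ x =
        ∫ x, rieszPotential α p u x * |u x| ^ (p - 2) * u x * φ x

end

open Metric Set Filter Topology NNReal

/-! The identity expresses that the action functional is stationary along the dilations `x ↦ u(tx)`: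
formally one tests the equation with `x · ∇u`. This function is neither smooth nor compactly
supported, so the test function used is `dilationTest`, namely `η(x) ∑ᵢ xᵢ (∂ᵢu)ₙ(x)` with a smooth
cut-off `η` and a mollified gradient.

With `η` fixed, the mollification is removed. Local square integrability of the second derivatives
handles the gradient term: the symmetry of the Hessian turns `∇u · D²u x` into `½ ∇|∇u|² · x`, which
is integrated by parts (`tendsto_integral_inner_gradient_dilationTest`). The term in `u` is treated
as `½ ∇(u²) · x`. In the nonlocal term the test functions converge in `L^q`, `q = 2Np/(N+α)`,
because `∇u ∈ L^q`. The Hardy–Littlewood–Sobolev inequality with exponent `2N/(N+α) = q/p`, combined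
with Hölder, makes the nonlocal pairing continuous for this convergence.

The limiting nonlocal term is rewritten with the chain rule for `f = |u|^p`. Its double integral of
`f(y) η(x) x·∇f(x) |x-y|^{-(N-α)}` is integrated by parts and symmetrised in `x` and `y`
(`integral_riesz_identity`). Symmetrisation is essential: the derivative of the kernel appears only
against the difference `η(x)x - η(y)y`, and the Lipschitz bound on this field compensates the extra
singularity on the diagonal. The kernel is first replaced by `(|z|² + ε)^{-(N-α)/2}` to justify the
integration by parts.

These computations form `localized_pohozaev`. Finally `η` is a fixed bump dilated by `n + 1`. The
quantities `div(η x)`, `|x||∇η|` and the Lipschitz constant of `η x` are bounded uniformly in `n`,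
so dominated convergence gives the global identity (`pohozaev_of_localized`). -/

/-- Euclidean space of dimension `N`. -/
abbrev Euc (N : ℕ) := EuclideanSpace ℝ (Fin N)

/-! ### Power weights and the Hardy–Littlewood–Sobolev inequality. -/

/-- Homogeneity under `z ↦ R⁻¹z`. It reduces the integrals over balls and their complements to
radius one, so that only finiteness there has to be checked. -/
lemma setLIntegral_norm_rpow_scale {N : ℕ} {S : Set (Euc N)} (hS : MeasurableSet S) (s : ℝ)
    {R : ℝ} (hR : 0 < R) :
    ∫⁻ z in (fun z => R⁻¹ • z) ⁻¹' S, ENNReal.ofReal (‖z‖ ^ s) =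
      ENNReal.ofReal (R ^ (N + s)) * ∫⁻ z in S, ENNReal.ofReal (‖z‖ ^ s) := by
  have hmeas : Measurable fun z : Euc N => R⁻¹ • z := measurable_const_smul _
  have hk : Measurable fun z : Euc N => ENNReal.ofReal (‖z‖ ^ s) := by fun_prop
  have h1 : ∫⁻ z in S, ENNReal.ofReal (‖z‖ ^ s)
        ∂(Measure.map (fun z : Euc N => R⁻¹ • z) volume)
      = ∫⁻ z in (fun z => R⁻¹ • z) ⁻¹' S, ENNReal.ofReal (‖R⁻¹ • z‖ ^ s) :=
    setLIntegral_map hS hk hmeas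
  rw [Measure.map_addHaar_smul _ (inv_ne_zero hR.ne')] at h1
  simp only [finrank_euclideanSpace, Fintype.card_fin, Measure.restrict_smul,
    lintegral_smul_measure, smul_eq_mul] at h1
  have h2 : ∀ z : Euc N, ENNReal.ofReal (‖R⁻¹ • z‖ ^ s) =
      ENNReal.ofReal (R ^ (-s)) * ENNReal.ofReal (‖z‖ ^ s) := fun z => by
    rw [← ENNReal.ofReal_mul (by positivity), norm_smul, Real.mul_rpow (norm_nonneg _)
      (norm_nonneg _), Real.norm_of_nonneg (by positivity), Real.inv_rpow hR.le,
      Real.rpow_neg hR.le]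
  simp_rw [h2] at h1
  rw [lintegral_const_mul _ hk] at h1
  have h3 : ENNReal.ofReal (R ^ s) * ENNReal.ofReal (R ^ (-s)) = 1 := by
    rw [← ENNReal.ofReal_mul (by positivity), ← Real.rpow_add hR]; simp
  rw [← one_mul (∫⁻ z in (fun z => R⁻¹ • z) ⁻¹' S, ENNReal.ofReal (‖z‖ ^ s)), ← h3, mul_assoc,
    ← h1, ← mul_assoc, ← ENNReal.ofReal_mul (by positivity), Real.rpow_add hR, Real.rpow_natCast]
  congr 2
  rw [abs_of_nonneg (by positivity), inv_pow, inv_inv, mul_comm]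

lemma setLIntegral_ball_norm_rpow {N : ℕ} {lam : ℝ} (h0 : 0 < lam) (hN : lam < N) :
    ∃ C : ℝ≥0∞, C ≠ ⊤ ∧ ∀ R : ℝ, 0 < R → ∫⁻ z in ball (0 : Euc N) R,
      ENNReal.ofReal (‖z‖ ^ (-lam)) ≤ C * ENNReal.ofReal (R ^ (N - lam)) := by
  have hNpos : 0 < N := by
    have : (0 : ℝ) < N := h0.trans hN
    exact_mod_cast this
  have : Nontrivial (Euc N) := by
    have : Nonempty (Fin N) := ⟨⟨0, hNpos⟩⟩
    infer_instance
  refine ⟨∫⁻ z in ball (0 : Euc N) 1, ENNReal.ofReal (‖z‖ ^ (-lam)), ?_, fun R hR => ?_⟩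
  · have hi : IntegrableOn (fun z : Euc N => ‖z‖ ^ (-lam)) (ball 0 1) volume := by
      rw [integrableOn_fun_norm_addHaar volume (f := fun y : ℝ => y ^ (-lam))]
      have : IntegrableOn (fun y : ℝ => y ^ ((N : ℝ) - 1 - lam)) (Ioo 0 1) volume :=
        (intervalIntegral.integrableOn_Ioo_rpow_iff one_pos).2 (by linarith)
      refine this.congr_fun (fun y hy => ?_) measurableSet_Ioo
      simp only [finrank_euclideanSpace, Fintype.card_fin, smul_eq_mul]
      rw [← Real.rpow_natCast, ← Real.rpow_add hy.1, Nat.cast_sub hNpos, sub_eq_add_neg _ lam]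
      simp
    have := hi.lintegral_lt_top
    exact this.ne
  · have := setLIntegral_norm_rpow_scale (N := N) (S := ball 0 1) measurableSet_ball (-lam) hR
    have hb : (fun z : Euc N => R⁻¹ • z) ⁻¹' ball 0 1 = ball 0 R := by
      ext z
      simp [norm_smul, abs_of_pos hR, inv_mul_lt_iff₀ hR]
    rw [hb] at this
    rw [this, mul_comm, sub_eq_add_neg]

/-- The exponent `2N` is the one produced by Hölder in the far region, where `‖z‖ ^ (-lam)` is
raised to the power `2N / lam`. Finiteness for radius one follows by comparison with `(1 + ‖z‖) ^
(-2N)`. -/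
lemma setLIntegral_compl_ball_norm_rpow {N : ℕ} (hN : 0 < N) :
    ∃ C : ℝ≥0∞, C ≠ ⊤ ∧ ∀ R : ℝ, 0 < R → ∫⁻ z in (ball (0 : Euc N) R)ᶜ,
      ENNReal.ofReal (‖z‖ ^ (-(2 * N : ℝ))) ≤ C * ENNReal.ofReal (R ^ (-(N : ℝ))) := by
  have hN' : (0 : ℝ) < N := by exact_mod_cast hN
  refine ⟨∫⁻ z in (ball (0 : Euc N) 1)ᶜ, ENNReal.ofReal (‖z‖ ^ (-(2 * N : ℝ))), ?_,
    fun R hR => ?_⟩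
  · have hi : Integrable (fun z : Euc N => (1 + ‖z‖) ^ (-(2 * N : ℝ))) volume := by
      apply integrable_one_add_norm
      simp only [finrank_euclideanSpace, Fintype.card_fin]
      linarith
    have hi2 := ((hi.const_mul ((2 : ℝ) ^ (2 * N : ℝ))).lintegral_lt_top)
    refine ne_top_of_le_ne_top hi2.ne ((setLIntegral_mono (by fun_prop) fun z hz => ?_).trans
      (setLIntegral_le_lintegral _ _))
    apply ENNReal.ofReal_le_ofReal
    have hz1 : 1 ≤ ‖z‖ := by simpa using hz
    have hz0 : 0 < ‖z‖ := by linarith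
    have h2 : (2 * ‖z‖) ^ (-(2 * N : ℝ)) ≤ (1 + ‖z‖) ^ (-(2 * N : ℝ)) :=
      Real.rpow_le_rpow_of_nonpos (by linarith) (by linarith) (by linarith)
    rw [Real.mul_rpow (by norm_num) hz0.le, Real.rpow_neg (by norm_num)] at h2
    calc ‖z‖ ^ (-(2 * N : ℝ)) = (2 : ℝ) ^ (2 * N : ℝ) *
          (((2 : ℝ) ^ (2 * N : ℝ))⁻¹ * ‖z‖ ^ (-(2 * N : ℝ))) := by
          rw [← mul_assoc, mul_inv_cancel₀ (by positivity), one_mul]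
      _ ≤ _ := by gcongr
  · have := setLIntegral_norm_rpow_scale (N := N) (S := (ball 0 1)ᶜ) measurableSet_ball.compl
      (-(2 * N : ℝ)) hR
    have hb : (fun z : Euc N => R⁻¹ • z) ⁻¹' (ball 0 1)ᶜ = (ball 0 R)ᶜ := by
      ext z
      simp [norm_smul, abs_of_pos hR, le_inv_mul_iff₀ hR]
    rw [hb] at this
    rw [this, mul_comm]
    apply le_of_eq
    congr 3
    ring

/-- The integral is split at a radius `R` around `x`. Near `x`, `h` is bounded by `a` and the kernel
is integrable; far from `x`, Hölder uses the normalisation of `h` and the decay of the kernel. -/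
lemma riesz_truncated_bound {N : ℕ} {lam r : ℝ} (h0 : 0 < lam) (hN : lam < N)
    (hr : r = 2 * N / (2 * N - lam)) :
    ∃ C : ℝ≥0∞, C ≠ ⊤ ∧ ∀ h : Euc N → ℝ≥0, Measurable h → ∫⁻ y, (h y : ℝ≥0∞) ^ r ≤ 1 →
      ∀ (a : ℝ≥0) (x : Euc N), (a : ℝ≥0∞) * ∫⁻ y in {y | h y ≤ a},
        h y * ENNReal.ofReal (‖x - y‖ ^ (-lam)) ≤ C * (a : ℝ≥0∞) ^ r := by
  obtain ⟨C1, hC1, hB1⟩ := setLIntegral_ball_norm_rpow h0 hN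
  have hNpos : 0 < N := by
    have : (0 : ℝ) < N := h0.trans hN
    exact_mod_cast this
  have hN' : (0 : ℝ) < N := by exact_mod_cast hNpos
  obtain ⟨C2, hC2, hB2⟩ := setLIntegral_compl_ball_norm_rpow hNpos
  have hd : 0 < 2 * (N : ℝ) - lam := by linarith
  have hr1 : 1 < r := by rw [hr, lt_div_iff₀ hd]; linarith
  refine ⟨C1 + C2 ^ (lam / (2 * N)), by finiteness, fun h hm hh a x => ?_⟩
  rcases eq_or_ne a 0 with rfl | ha
  · simp
  have ha' : 0 < (a : ℝ) := by exact_mod_cast pos_iff_ne_zero.2 ha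
  -- This radius balances the two regions: `a² R^(N - lam)` and `a R^(-lam/2)` both equal `a^r`.
  set R : ℝ := (a : ℝ) ^ (-(2 / (2 * N - lam))) with hRdef
  have hR : 0 < R := by positivity
  have hk : Measurable fun y : Euc N => ENNReal.ofReal (‖x - y‖ ^ (-lam)) := by fun_prop
  have hsplit := lintegral_inter_add_sdiff (μ := volume)
    (fun y => (h y : ℝ≥0∞) * ENNReal.ofReal (‖x - y‖ ^ (-lam))) {y | h y ≤ a}
    (measurableSet_ball (x := x) (ε := R))
  have hnear : ∫⁻ y in {y | h y ≤ a} ∩ ball x R, (h y : ℝ≥0∞) * ENNReal.ofReal (‖x - y‖ ^ (-lam))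
      ≤ a * (C1 * ENNReal.ofReal (R ^ (N - lam))) := by
    calc _ ≤ ∫⁻ y in {y | h y ≤ a} ∩ ball x R, (a : ℝ≥0∞) * ENNReal.ofReal (‖x - y‖ ^ (-lam)) :=
          setLIntegral_mono (by fun_prop) fun y hy => by
            gcongr
            exact hy.1
      _ ≤ ∫⁻ y in ball x R, (a : ℝ≥0∞) * ENNReal.ofReal (‖x - y‖ ^ (-lam)) :=
          lintegral_mono_set inter_subset_right
      _ = a * ∫⁻ y in ball x R, ENNReal.ofReal (‖x - y‖ ^ (-lam)) := lintegral_const_mul _ hk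
      _ = a * ∫⁻ y in ball (0 : Euc N) R, ENNReal.ofReal (‖y‖ ^ (-lam)) := by
          congr 1
          rw [← lintegral_indicator measurableSet_ball, ← lintegral_indicator measurableSet_ball,
            ← lintegral_sub_left_eq_self _ x]
          congr 1
          ext y
          simp [indicator, dist_eq_norm]
      _ ≤ _ := by gcongr; exact hB1 R hR
  have hconj : r.HolderConjugate (2 * N / lam) := by
    rw [Real.holderConjugate_iff]
    refine ⟨hr1, ?_⟩
    rw [hr]; field_simp; ring
  have hfar : ∫⁻ y in {y | h y ≤ a} \ ball x R, (h y : ℝ≥0∞) * ENNReal.ofReal (‖x - y‖ ^ (-lam))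
      ≤ (C2 * ENNReal.ofReal (R ^ (-(N : ℝ)))) ^ (lam / (2 * N)) := by
    calc _ ≤ ∫⁻ y in (ball x R)ᶜ, (h y : ℝ≥0∞) * ENNReal.ofReal (‖x - y‖ ^ (-lam)) :=
          lintegral_mono_set fun y hy => hy.2
      _ ≤ (∫⁻ y in (ball x R)ᶜ, (h y : ℝ≥0∞) ^ r) ^ (1 / r) *
          (∫⁻ y in (ball x R)ᶜ, ENNReal.ofReal (‖x - y‖ ^ (-lam)) ^ (2 * N / lam)) ^
            (1 / (2 * N / lam)) :=
          ENNReal.lintegral_mul_le_Lp_mul_Lq _ hconj (by fun_prop) hk.aemeasurable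
      _ ≤ 1 ^ (1 / r) * (C2 * ENNReal.ofReal (R ^ (-(N : ℝ)))) ^ (1 / (2 * N / lam)) := by
          gcongr
          · exact (setLIntegral_le_lintegral _ _).trans hh
          · refine le_trans (le_of_eq ?_) (hB2 R hR)
            rw [← lintegral_indicator measurableSet_ball.compl,
              ← lintegral_indicator measurableSet_ball.compl, ← lintegral_sub_left_eq_self _ x]
            congr 1
            ext y
            have he : ENNReal.ofReal (‖y‖ ^ (-lam)) ^ (2 * N / lam) =
                ENNReal.ofReal (‖y‖ ^ (-(2 * N : ℝ))) := by
              rw [ENNReal.ofReal_rpow_of_nonneg (by positivity) (by positivity),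
                ← Real.rpow_mul (norm_nonneg _)]
              congr 2
              field_simp
            simp [indicator, dist_eq_norm, he]
      _ = _ := by rw [ENNReal.one_rpow, one_mul, one_div_div]
  have hA : (a : ℝ≥0∞) = ENNReal.ofReal a := by simp
  have e1 : (a : ℝ≥0∞) * (a * (C1 * ENNReal.ofReal (R ^ (N - lam)))) = C1 * (a : ℝ≥0∞) ^ r := by
    have : (a : ℝ≥0∞) ^ r = a * (a * ENNReal.ofReal (R ^ (N - lam))) := by
      rw [hA, ENNReal.ofReal_rpow_of_pos ha', ← ENNReal.ofReal_mul ha'.le,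
        ← ENNReal.ofReal_mul ha'.le, hRdef, ← Real.rpow_mul ha'.le]
      congr 1
      nth_rewrite 2 [← Real.rpow_one (a : ℝ)]
      nth_rewrite 3 [← Real.rpow_one (a : ℝ)]
      rw [← Real.rpow_add ha', ← Real.rpow_add ha', hr]
      congr 1
      field_simp
      ring
    rw [this]; ring
  have e2 : (a : ℝ≥0∞) * (C2 * ENNReal.ofReal (R ^ (-(N : ℝ)))) ^ (lam / (2 * N))
      = C2 ^ (lam / (2 * N)) * (a : ℝ≥0∞) ^ r := by
    have : (a : ℝ≥0∞) ^ r = a * ENNReal.ofReal (R ^ (-(N : ℝ))) ^ (lam / (2 * N)) := by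
      rw [hA, ENNReal.ofReal_rpow_of_pos ha', ENNReal.ofReal_rpow_of_pos (by positivity),
        ← ENNReal.ofReal_mul ha'.le, hRdef, ← Real.rpow_mul ha'.le, ← Real.rpow_mul ha'.le]
      congr 1
      nth_rewrite 2 [← Real.rpow_one (a : ℝ)]
      rw [← Real.rpow_add ha', hr]
      congr 1
      field_simp
      ring
    rw [this, ENNReal.mul_rpow_of_nonneg _ _ (by positivity)]; ring
  rw [← hsplit, mul_add, add_mul, ← e1, ← e2]
  gcongr

/-- The Hardy–Littlewood–Sobolev inequality on the diagonal, for normalised functions. -/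
lemma hardy_littlewood_sobolev_normalized {N : ℕ} {lam r : ℝ} (h0 : 0 < lam) (hN : lam < N)
    (hr : r = 2 * N / (2 * N - lam)) :
    ∃ C : ℝ≥0∞, C ≠ ⊤ ∧ ∀ f h : Euc N → ℝ≥0, Measurable f → Measurable h →
      ∫⁻ y, (f y : ℝ≥0∞) ^ r ≤ 1 → ∫⁻ y, (h y : ℝ≥0∞) ^ r ≤ 1 →
      ∫⁻ x, ∫⁻ y, (f x : ℝ≥0∞) * h y * ENNReal.ofReal (‖x - y‖ ^ (-lam)) ≤ C := by
  obtain ⟨C, hC, hB⟩ := riesz_truncated_bound h0 hN hr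
  refine ⟨C + C, by finiteness, fun f h hf hh hf1 hh1 => ?_⟩
  have hmf : Measurable fun z : Euc N × Euc N =>
      (f z.1 : ℝ≥0∞) * h z.2 * ENNReal.ofReal (‖z.1 - z.2‖ ^ (-lam)) := by fun_prop
  -- Taking `a = f x` in the truncated bound leaves a multiple of `f x ^ r`, which integrates to at
  -- most a constant. The region `h y > f x` is the same situation with the roles of `f` and `h`
  -- exchanged by Tonelli.
  have key : ∀ f h : Euc N → ℝ≥0, Measurable f → Measurable h →
      ∫⁻ y, (f y : ℝ≥0∞) ^ r ≤ 1 → ∫⁻ y, (h y : ℝ≥0∞) ^ r ≤ 1 →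
      ∫⁻ x, ∫⁻ y in {y | h y ≤ f x}, (f x : ℝ≥0∞) * h y * ENNReal.ofReal (‖x - y‖ ^ (-lam))
        ≤ C := by
    intro f h hf hh hf1 hh1
    calc _ ≤ ∫⁻ x, C * (f x : ℝ≥0∞) ^ r := lintegral_mono fun x => by
          simp_rw [mul_assoc]
          rw [lintegral_const_mul _ (by fun_prop)]
          exact hB h hh hh1 (f x) x
      _ = C * ∫⁻ x, (f x : ℝ≥0∞) ^ r := lintegral_const_mul _ (by fun_prop)
      _ ≤ C * 1 := by gcongr
      _ = C := mul_one C
  have h1 := key f h hf hh hf1 hh1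
  have h2 := key h f hh hf hh1 hf1
  have hsw : ∫⁻ x, ∫⁻ y in {y | h y ≤ f x}ᶜ,
      (f x : ℝ≥0∞) * h y * ENNReal.ofReal (‖x - y‖ ^ (-lam)) ≤ C := by
    refine le_trans ?_ h2
    have hS : MeasurableSet {z : Euc N × Euc N | f z.1 ≤ h z.2} :=
      measurableSet_le (by fun_prop) (by fun_prop)
    calc _ ≤ ∫⁻ x, ∫⁻ y, {z : Euc N × Euc N | f z.1 ≤ h z.2}.indicator (fun z =>
            (f z.1 : ℝ≥0∞) * h z.2 * ENNReal.ofReal (‖z.1 - z.2‖ ^ (-lam))) (x, y) := by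
          refine lintegral_mono fun x => ?_
          rw [← lintegral_indicator (measurableSet_le hh measurable_const).compl]
          refine lintegral_mono fun y => ?_
          by_cases hxy : h y ≤ f x
          · simp [indicator, hxy]
          · simp [indicator, hxy, (not_le.1 hxy).le]
      _ = ∫⁻ y, ∫⁻ x, {z : Euc N × Euc N | f z.1 ≤ h z.2}.indicator (fun z =>
            (f z.1 : ℝ≥0∞) * h z.2 * ENNReal.ofReal (‖z.1 - z.2‖ ^ (-lam))) (x, y) :=
          lintegral_lintegral_swap (hmf.indicator hS).aemeasurable
      _ = _ := by
          refine lintegral_congr fun y => ?_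
          rw [← lintegral_indicator (measurableSet_le hf measurable_const)]
          refine lintegral_congr fun x => ?_
          simp only [indicator, mem_ofPred_eq, norm_sub_rev x y, mul_comm (f x : ℝ≥0∞)]
  calc _ = ∫⁻ x, ((∫⁻ y in {y | h y ≤ f x},
          (f x : ℝ≥0∞) * h y * ENNReal.ofReal (‖x - y‖ ^ (-lam))) + ∫⁻ y in {y | h y ≤ f x}ᶜ,
            (f x : ℝ≥0∞) * h y * ENNReal.ofReal (‖x - y‖ ^ (-lam))) :=
        lintegral_congr fun x =>
          (lintegral_add_compl _ (measurableSet_le hh measurable_const)).symm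
    _ = _ := by
        refine lintegral_add_left ?_ _
        have hS : MeasurableSet {z : Euc N × Euc N | h z.2 ≤ f z.1} :=
          measurableSet_le (by fun_prop) (by fun_prop)
        have := (hmf.indicator hS).lintegral_prod_right' (ν := volume)
        have he : (fun x => ∫⁻ y in {y | h y ≤ f x},
            (f x : ℝ≥0∞) * h y * ENNReal.ofReal (‖x - y‖ ^ (-lam))) = fun x => ∫⁻ y,
            {z : Euc N × Euc N | h z.2 ≤ f z.1}.indicator (fun z =>
            (f z.1 : ℝ≥0∞) * h z.2 * ENNReal.ofReal (‖z.1 - z.2‖ ^ (-lam))) (x, y) := by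
          ext x
          rw [← lintegral_indicator (measurableSet_le hh measurable_const)]
          rfl
        rw [he]
        exact this
    _ ≤ C + C := add_le_add h1 hsw

/-- The Hardy–Littlewood–Sobolev inequality on the diagonal. -/
lemma hardy_littlewood_sobolev {N : ℕ} {lam r : ℝ} (h0 : 0 < lam) (hN : lam < N)
    (hr : r = 2 * N / (2 * N - lam)) :
    ∃ C : ℝ≥0∞, C ≠ ⊤ ∧ ∀ f h : Euc N → ℝ, MemLp f (ENNReal.ofReal r) volume →
      MemLp h (ENNReal.ofReal r) volume →
      ∫⁻ x, ∫⁻ y, ‖f x‖ₑ * ‖h y‖ₑ * ENNReal.ofReal (‖x - y‖ ^ (-lam)) ≤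
        C * eLpNorm f (ENNReal.ofReal r) volume * eLpNorm h (ENNReal.ofReal r) volume := by
  obtain ⟨C, hC, hB⟩ := hardy_littlewood_sobolev_normalized h0 hN hr
  have hN' : (0 : ℝ) < N := h0.trans hN
  have hd : 0 < 2 * (N : ℝ) - lam := by linarith
  have hr1 : 1 < r := by rw [hr, lt_div_iff₀ hd]; linarith
  have hr0 : ENNReal.ofReal r ≠ 0 := by simp; linarith
  refine ⟨C, hC, fun f h hf hh => ?_⟩
  have norml : ∀ f : Euc N → ℝ, MemLp f (ENNReal.ofReal r) volume →
      eLpNorm f (ENNReal.ofReal r) volume ≠ 0 →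
      ∃ F : Euc N → ℝ≥0, Measurable F ∧ ∫⁻ y, (F y : ℝ≥0∞) ^ r ≤ 1 ∧
        ∀ᵐ x, ‖f x‖ₑ = eLpNorm f (ENNReal.ofReal r) volume * F x := by
    intro f hf hf0
    have hft := hf.2.ne
    set M := eLpNorm f (ENNReal.ofReal r) volume
    refine ⟨fun x => ‖hf.1.mk f x‖₊ / M.toNNReal, ?_, ?_, ?_⟩
    · have := hf.1.stronglyMeasurable_mk.measurable
      fun_prop
    · have hM0 : M.toNNReal ≠ 0 := by simp [ENNReal.toNNReal_eq_zero_iff, hf0, hft]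
      have : ∀ y, (((‖hf.1.mk f y‖₊ / M.toNNReal : ℝ≥0)) : ℝ≥0∞) ^ r =
          (M ^ r)⁻¹ * ‖hf.1.mk f y‖ₑ ^ r := fun y => by
        rw [ENNReal.coe_div hM0, ENNReal.coe_toNNReal hft, ENNReal.div_rpow_of_nonneg _ _
          (by linarith), mul_comm]
        rfl
      simp_rw [this]
      rw [lintegral_const_mul _ (by
        have := hf.1.stronglyMeasurable_mk.measurable
        fun_prop)]
      have h3 : ∫⁻ y, ‖hf.1.mk f y‖ₑ ^ r = M ^ r := by
        have hM' : M = eLpNorm (hf.1.mk f) (ENNReal.ofReal r) volume :=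
          eLpNorm_congr_ae hf.1.ae_eq_mk
        rw [eLpNorm_eq_lintegral_rpow_enorm_toReal hr0 ENNReal.ofReal_ne_top] at hM'
        rw [hM', ENNReal.toReal_ofReal (by linarith), ← ENNReal.rpow_mul,
          one_div_mul_cancel (by linarith), ENNReal.rpow_one]
      rw [h3, ENNReal.inv_mul_cancel]
      · simp [hf0, hft]
      · exact ENNReal.rpow_ne_top_of_nonneg (by linarith) hft
    · filter_upwards [hf.1.ae_eq_mk] with x hx
      have hM0 : M.toNNReal ≠ 0 := by simp [ENNReal.toNNReal_eq_zero_iff, hf0, hft]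
      rw [ENNReal.coe_div hM0, ENNReal.coe_toNNReal hft, ← hx, ENNReal.mul_div_cancel hf0 hft]
      rfl
  rcases eq_or_ne (eLpNorm f (ENNReal.ofReal r) volume) 0 with hf0 | hf0
  · rw [eLpNorm_eq_zero_iff hf.1 hr0] at hf0
    have : ∀ᵐ x, ∫⁻ y, ‖f x‖ₑ * ‖h y‖ₑ * ENNReal.ofReal (‖x - y‖ ^ (-lam)) = 0 := by
      filter_upwards [hf0] with x hx
      simp [hx]
    rw [lintegral_congr_ae this]
    simp
  rcases eq_or_ne (eLpNorm h (ENNReal.ofReal r) volume) 0 with hh0 | hh0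
  · rw [eLpNorm_eq_zero_iff hh.1 hr0] at hh0
    have : ∀ x, ∫⁻ y, ‖f x‖ₑ * ‖h y‖ₑ * ENNReal.ofReal (‖x - y‖ ^ (-lam)) = 0 := fun x => by
      rw [← lintegral_zero (μ := (volume : Measure (Euc N)))]
      apply lintegral_congr_ae
      filter_upwards [hh0] with y hy
      simp [hy]
    simp [this]
  obtain ⟨F, hFm, hF1, hFe⟩ := norml f hf hf0
  obtain ⟨H, hHm, hH1, hHe⟩ := norml h hh hh0
  have := hB F H hFm hHm hF1 hH1
  set A := eLpNorm f (ENNReal.ofReal r) volume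
  set B := eLpNorm h (ENNReal.ofReal r) volume
  calc _ = ∫⁻ x, ∫⁻ y, (A * B) * ((F x : ℝ≥0∞) * H y * ENNReal.ofReal (‖x - y‖ ^ (-lam))) := by
        apply lintegral_congr_ae
        filter_upwards [hFe] with x hx
        apply lintegral_congr_ae
        filter_upwards [hHe] with y hy
        rw [hx, hy]; ring
    _ = (A * B) * ∫⁻ x, ∫⁻ y, (F x : ℝ≥0∞) * H y * ENNReal.ofReal (‖x - y‖ ^ (-lam)) := by
        have hmf : Measurable fun z : Euc N × Euc N =>
          (F z.1 : ℝ≥0∞) * H z.2 * ENNReal.ofReal (‖z.1 - z.2‖ ^ (-lam)) := by fun_prop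
        rw [← lintegral_const_mul _ hmf.lintegral_prod_right']
        refine lintegral_congr fun x => ?_
        rw [lintegral_const_mul _ (by fun_prop)]
    _ ≤ (A * B) * C := by gcongr
    _ = C * A * B := by ring

/-! ### Mollification and its convergence. -/

/-- Translations form a continuous family of measure-preserving maps, and composition with such a
family is continuous in `L^q` for finite `q`. -/
lemma tendsto_eLpNorm_translate_sub {N : ℕ} {q : ℝ≥0∞} (hq1 : 1 ≤ q) (hq : q ≠ ⊤) {v : Euc N → ℝ}
    (hv : MemLp v q volume) :
    Tendsto (fun t => eLpNorm (fun x => v (x - t) - v x) q volume) (𝓝 0) (𝓝 0) := by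
  have : Fact (1 ≤ q) := ⟨hq1⟩
  let G : C(Euc N × Euc N, Euc N) := ⟨fun z => z.2 - z.1, by fun_prop⟩
  have hG : Tendsto (fun t => G.curry t) (𝓝 0) (𝓝 (G.curry 0)) := G.curry.continuous.tendsto 0
  have hmp : ∀ t, MeasurePreserving (G.curry t) (volume : Measure (Euc N)) volume := fun t =>
    measurePreserving_sub_right volume t
  have h := (tendsto_const_nhds (x := hv.toLp v)).compMeasurePreservingLp hG hmp (hmp 0) hq
  rw [Lp.tendsto_Lp_iff_tendsto_eLpNorm'] at h
  refine h.congr fun t => ?_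
  apply eLpNorm_congr_ae
  have h1 := Lp.coeFn_compMeasurePreserving (hv.toLp v) (hmp t)
  have h2 := Lp.coeFn_compMeasurePreserving (hv.toLp v) (hmp 0)
  have h3 := (hmp t).quasiMeasurePreserving.ae_eq_comp hv.coeFn_toLp
  filter_upwards [h1, h2, h3, hv.coeFn_toLp] with x hx1 hx2 hx3 hx4
  simp only [Pi.sub_apply, hx1, hx2, hx3]
  simp only [Function.comp_apply, ContinuousMap.curry_apply, G, ContinuousMap.coe_mk, sub_zero, hx4]

/-- A sequence of bump functions shrinking to the origin. -/
noncomputable def mollifier (N n : ℕ) : ContDiffBump (0 : Euc N) where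
  rIn := 1 / (2 * (n + 1))
  rOut := 1 / (n + 1)
  rIn_pos := by positivity
  rIn_lt_rOut := by
    apply one_div_lt_one_div_of_lt (by positivity)
    linarith [show (0 : ℝ) ≤ n from n.cast_nonneg]

/-- Convolution with the normalised `n`-th bump function. -/
noncomputable def mollify {N : ℕ} (n : ℕ) (v : Euc N → ℝ) : Euc N → ℝ :=
  convolution ((mollifier N n).normed volume) v (ContinuousLinearMap.lsmul ℝ ℝ) volume

lemma mollifier_rOut_le_one (N n : ℕ) : (mollifier N n).rOut ≤ 1 := by
  change 1 / ((n : ℝ) + 1) ≤ 1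
  rw [div_le_one (by positivity)]
  linarith [show (0 : ℝ) ≤ n from n.cast_nonneg]

lemma tendsto_mollifier_rOut (N : ℕ) : Tendsto (fun n => (mollifier N n).rOut) atTop (𝓝 0) :=
  tendsto_one_div_add_atTop_nhds_zero_nat

lemma mollify_contDiff {N : ℕ} (n : ℕ) {v : Euc N → ℝ} (hv : LocallyIntegrable v volume) :
    ContDiff ℝ ∞ (mollify n v) :=
  ((mollifier N n).hasCompactSupport_normed).contDiff_convolution_left _
    ((mollifier N n).contDiff_normed) hv

/-- Lebesgue differentiation. The shrinking bumps need a bounded ratio of outer to inner radius,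
here exactly two. -/
lemma mollify_ae_tendsto {N : ℕ} {v : Euc N → ℝ} (hv : LocallyIntegrable v volume) :
    ∀ᵐ x, Tendsto (fun n => mollify n v x) atTop (𝓝 (v x)) := by
  refine ContDiffBump.ae_convolution_tendsto_right_of_locallyIntegrable (K := 2)
    (tendsto_mollifier_rOut N) (Eventually.of_forall fun n => ?_) hv
  change 1 / ((n : ℝ) + 1) ≤ 2 * (1 / (2 * (n + 1)))
  apply le_of_eq
  field_simp

/-- The derivative falls on the bump `ρ`, and `y ↦ ρ (x - y)` is an admissible test function. The
sign from the reflection cancels the one in the definition of the weak derivative. -/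
lemma fderiv_mollify {N : ℕ} (n : ℕ) {i : Fin N} {u v : Euc N → ℝ} (h : HasWeakPartial i u v)
    (x : Euc N) : fderiv ℝ (mollify n u) x (EuclideanSpace.single i 1) = mollify n v x := by
  set ρ := (mollifier N n).normed volume with hρ
  have hc : HasCompactSupport ρ := (mollifier N n).hasCompactSupport_normed
  have hs : ContDiff ℝ ∞ ρ := (mollifier N n).contDiff_normed
  have hd := hc.hasFDerivAt_convolution_left (ContinuousLinearMap.lsmul ℝ ℝ) (hs.of_le (by simp))
    h.1 x
  have hex : ConvolutionExistsAt (fderiv ℝ ρ) u x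
      ((ContinuousLinearMap.lsmul ℝ ℝ).precompL (Euc N)) volume :=
    (hc.fderiv (𝕜 := ℝ)).convolutionExists_left _ (hs.continuous_fderiv (by simp)) h.1 x
  have h1 : fderiv ℝ (mollify n u) x (EuclideanSpace.single i 1) =
      ∫ t, fderiv ℝ ρ t (EuclideanSpace.single i 1) * u (x - t) := by
    rw [show fderiv ℝ (mollify n u) x = _ from hd.fderiv, convolution_def,
      ContinuousLinearMap.integral_apply hex]
    rfl
  have h2 : ∫ t, fderiv ℝ ρ t (EuclideanSpace.single i 1) * u (x - t) =
      ∫ y, fderiv ℝ ρ (x - y) (EuclideanSpace.single i 1) * u y := by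
    rw [← integral_sub_left_eq_self _ volume x]
    simp
  have h3 := h.2.2 (fun y => ρ (x - y)) (by fun_prop)
    (hc.comp_homeomorph (Homeomorph.subLeft x))
  have h4 : ∀ y, fderiv ℝ (fun y => ρ (x - y)) y (EuclideanSpace.single i 1) =
      - fderiv ℝ ρ (x - y) (EuclideanSpace.single i 1) := fun y => by
    have hρd : HasFDerivAt ρ (fderiv ℝ ρ (x - y)) (x - y) :=
      (hs.differentiable (by simp) _).hasFDerivAt
    have : HasFDerivAt (fun y => ρ (x - y)) _ y := hρd.comp y ((hasFDerivAt_id y).const_sub x)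
    rw [this.fderiv]
    simp
  rw [h1, h2]
  simp_rw [h4] at h3
  have h5 : mollify n v x = ∫ y, v y * ρ (x - y) := by
    rw [mollify, convolution_lsmul_swap]
    simp [mul_comm, hρ]
  rw [h5, ← neg_inj, ← h3, ← integral_neg]
  congr 1
  ext y
  ring

lemma mollify_eq_of_eqOn {N : ℕ} (n : ℕ) {v w : Euc N → ℝ} {R : ℝ}
    (h : EqOn v w (closedBall 0 (R + 1))) {x : Euc N} (hx : x ∈ closedBall 0 R) :
    mollify n v x = mollify n w x := by
  rw [mollify, mollify, convolution_def, convolution_def]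
  congr 1
  ext t
  by_cases ht : t ∈ ball (0 : Euc N) (mollifier N n).rOut
  · have : x - t ∈ closedBall (0 : Euc N) (R + 1) := by
      have h1 := mollifier_rOut_le_one N n
      simp only [mem_ball, mem_closedBall, dist_zero_right] at *
      linarith [norm_sub_le x t]
    rw [h this]
  · have : (mollifier N n).normed volume t = 0 := by
      rw [← Function.notMem_support, ContDiffBump.support_normed_eq]
      exact ht
    rw [this]; simp

lemma enorm_mollify_sub_le {N : ℕ} (n : ℕ) {v : Euc N → ℝ} (hv : LocallyIntegrable v volume)
    (x : Euc N) : ‖mollify n v x - v x‖ₑ ≤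
      ∫⁻ t, ENNReal.ofReal ((mollifier N n).normed volume t) * ‖v (x - t) - v x‖ₑ := by
  have hex : ConvolutionExistsAt ((mollifier N n).normed volume) v x
      (ContinuousLinearMap.lsmul ℝ ℝ) volume :=
    (mollifier N n).hasCompactSupport_normed.convolutionExists_left _
      (mollifier N n).continuous_normed hv x
  have h1 : mollify n v x - v x =
      ∫ t, (mollifier N n).normed volume t * (v (x - t) - v x) := by
    have h2 : v x = ∫ t, (mollifier N n).normed volume t * v x := by
      rw [integral_mul_const, (mollifier N n).integral_normed, one_mul]
    have h3 : Integrable (fun t => (mollifier N n).normed volume t * v x) :=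
      (mollifier N n).integrable_normed.mul_const _
    have h4 : Integrable (fun t => (mollifier N n).normed volume t * v (x - t)) := hex
    simp_rw [mul_sub]
    rw [integral_sub h4 h3, ← h2]
    rfl
  rw [h1]
  refine (enorm_integral_le_lintegral_enorm _).trans (le_of_eq ?_)
  congr 1
  ext t
  rw [enorm_mul, Real.enorm_of_nonneg ((mollifier N n).nonneg_normed t)]

/-- The density `ρ` defines a probability measure, so Jensen (as monotonicity of `eLpNorm` in the
exponent) and Tonelli bound the error by the largest translation error over the support of the bump.
Continuity of translations concludes. -/
lemma tendsto_eLpNorm_mollify_sub {N : ℕ} {q : ℝ≥0∞} (hq1 : 1 ≤ q) (hq : q ≠ ⊤) {v : Euc N → ℝ}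
    (hv : MemLp v q volume) :
    Tendsto (fun n => eLpNorm (fun x => mollify n v x - v x) q volume) atTop (𝓝 0) := by
  have hq0 : q ≠ 0 := by positivity
  have hqr : 0 < q.toReal := ENNReal.toReal_pos hq0 hq
  have hloc : LocallyIntegrable v volume := hv.locallyIntegrable hq1
  have key : ∀ n (ε : ℝ≥0∞), (∀ t ∈ ball (0 : Euc N) (mollifier N n).rOut,
      eLpNorm (fun x => v (x - t) - v x) q volume ≤ ε) →
      eLpNorm (fun x => mollify n v x - v x) q volume ≤ ε := by
    intro n ε hε
    set ρ := fun t => ENNReal.ofReal ((mollifier N n).normed volume t) with hρ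
    have hρm : Measurable ρ := (mollifier N n).continuous_normed.measurable.ennreal_ofReal
    have hρ1 : ∫⁻ t, ρ t = 1 := by
      rw [← ofReal_integral_eq_lintegral_ofReal (mollifier N n).integrable_normed
        (Eventually.of_forall (mollifier N n).nonneg_normed), (mollifier N n).integral_normed]
      simp
    set ν := (volume : Measure (Euc N)).withDensity ρ
    have : IsProbabilityMeasure ν := ⟨by rw [withDensity_apply _ MeasurableSet.univ]; simpa⟩
    have hac : ν ≪ volume := withDensity_absolutelyContinuous _ _
    have hjm : AEMeasurable (fun z : Euc N × Euc N => ‖v (z.1 - z.2) - v z.1‖ₑ ^ q.toReal)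
        (volume.prod volume) := by
      have h1 : AEStronglyMeasurable (fun z : Euc N × Euc N => v (z.1 - z.2))
          (volume.prod volume) :=
        hv.1.comp_quasiMeasurePreserving (quasiMeasurePreserving_sub_of_right_invariant _ _)
      exact ((h1.sub hv.1.comp_fst).enorm).pow_const _
    have hpt : ∀ x, ‖mollify n v x - v x‖ₑ ^ q.toReal ≤
        ∫⁻ t, ρ t * ‖v (x - t) - v x‖ₑ ^ q.toReal := by
      intro x
      have hm : AEStronglyMeasurable (fun t => v (x - t) - v x) volume :=
        (hv.1.comp_quasiMeasurePreserving
          (quasiMeasurePreserving_sub_left_of_right_invariant volume x)).sub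
          aestronglyMeasurable_const
      have hJ := eLpNorm_le_eLpNorm_of_exponent_le hq1 (hm.mono_ac hac)
      rw [eLpNorm_one_eq_lintegral_enorm,
        eLpNorm_eq_lintegral_rpow_enorm_toReal hq0 hq,
        lintegral_withDensity_eq_lintegral_mul₀ hρm.aemeasurable hm.enorm,
        lintegral_withDensity_eq_lintegral_mul₀ hρm.aemeasurable (hm.enorm.pow_const _)] at hJ
      have h2 := (enorm_mollify_sub_le n hloc x).trans hJ
      have h3 := ENNReal.rpow_le_rpow h2 hqr.le
      rw [← ENNReal.rpow_mul, one_div_mul_cancel hqr.ne', ENNReal.rpow_one] at h3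
      exact h3
    rw [eLpNorm_eq_lintegral_rpow_enorm_toReal hq0 hq, one_div,
      ENNReal.rpow_inv_le_iff hqr]
    calc _ ≤ ∫⁻ x, ∫⁻ t, ρ t * ‖v (x - t) - v x‖ₑ ^ q.toReal := lintegral_mono hpt
      _ = ∫⁻ t, ∫⁻ x, ρ t * ‖v (x - t) - v x‖ₑ ^ q.toReal := by
          refine lintegral_lintegral_swap ?_
          exact (hρm.comp measurable_snd).aemeasurable.mul hjm
      _ ≤ ∫⁻ t, ρ t * ε ^ q.toReal := by
          refine lintegral_mono fun t => ?_
          by_cases ht : t ∈ ball (0 : Euc N) (mollifier N n).rOut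
          · have := hε t ht
            rw [eLpNorm_eq_lintegral_rpow_enorm_toReal hq0 hq, one_div,
              ENNReal.rpow_inv_le_iff hqr] at this
            rw [lintegral_const_mul' _ _ ENNReal.ofReal_ne_top]
            gcongr
          · have : ρ t = 0 := by
              have h0 : (mollifier N n).normed volume t = 0 := by
                rw [← Function.notMem_support, ContDiffBump.support_normed_eq]
                exact ht
              simp [hρ, h0]
            simp [this]
      _ = ε ^ q.toReal := by rw [lintegral_mul_const _ hρm, hρ1, one_mul]
  rw [ENNReal.tendsto_nhds_zero]
  intro ε hε
  have h1 := (ENNReal.tendsto_nhds_zero.1 (tendsto_eLpNorm_translate_sub hq1 hq hv)) ε hε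
  obtain ⟨δ, hδ, hball⟩ := Metric.eventually_nhds_iff_ball.1 h1
  filter_upwards [(tendsto_mollifier_rOut N).eventually (gt_mem_nhds hδ)] with n hn
  exact key n ε fun t ht => hball t (ball_subset_ball hn.le ht)

/-- All bumps are supported in the unit ball, so on radius `R` only the values of `v` on radius `R +
1` matter, and `v` may be replaced by its restriction there. -/
lemma tendsto_eLpNorm_mollify_sub_closedBall {N : ℕ} {q : ℝ≥0∞} (hq1 : 1 ≤ q) (hq : q ≠ ⊤)
    {v : Euc N → ℝ} (hv : MemLpLoc q v) (R : ℝ) :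
    Tendsto (fun n => eLpNorm (fun x => mollify n v x - v x) q
      (volume.restrict (closedBall 0 R))) atTop (𝓝 0) := by
  have hw : MemLp ((closedBall 0 (R + 1)).indicator v) q volume :=
    (memLp_indicator_iff_restrict measurableSet_closedBall).2 (hv _ (isCompact_closedBall _ _))
  refine tendsto_of_tendsto_of_tendsto_of_le_of_le tendsto_const_nhds
    (tendsto_eLpNorm_mollify_sub hq1 hq hw) (fun _ => zero_le) fun n => ?_
  refine le_trans (le_of_eq ?_) (eLpNorm_restrict_le _ q volume (closedBall 0 R))
  apply eLpNorm_congr_ae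
  filter_upwards [ae_restrict_mem measurableSet_closedBall] with x hx
  have hx' : x ∈ closedBall (0 : Euc N) (R + 1) := closedBall_subset_closedBall (by linarith) hx
  rw [mollify_eq_of_eqOn n (w := (closedBall 0 (R + 1)).indicator v) (R := R) (fun y hy => by
    rw [indicator_of_mem hy]) hx, indicator_of_mem hx']

/-! ### The weak chain rule for powers. -/

lemma memLpLoc_one_of_locallyIntegrable {N : ℕ} {u : Euc N → ℝ}
    (hu : LocallyIntegrable u volume) : MemLpLoc 1 u := fun _ hK =>
  memLp_one_iff_integrable.2 (hu.integrableOn_isCompact hK)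

lemma MeasureTheory.LocallyIntegrable.norm {N : ℕ} {u : Euc N → ℝ}
    (hu : LocallyIntegrable u volume) : LocallyIntegrable (fun x => ‖u x‖) volume := fun x =>
  let ⟨s, hs, hi⟩ := hu x
  ⟨s, hs, hi.norm⟩

lemma exists_tsupport_subset_closedBall {N : ℕ} {ψ : Euc N → ℝ} (hψ : HasCompactSupport ψ) :
    ∃ R, tsupport ψ ⊆ closedBall 0 R :=
  hψ.isCompact.isBounded.subset_closedBall 0

lemma MeasureTheory.LocallyIntegrable.integrable_mul_of_hasCompactSupport {N : ℕ} {u ψ : Euc N → ℝ}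
    (hu : LocallyIntegrable u volume) (hψ : Continuous ψ) (hc : HasCompactSupport ψ) :
    Integrable (fun x => u x * ψ x) volume := by
  simpa [mul_comm] using hu.integrable_smul_left_of_hasCompactSupport hψ hc

lemma tendsto_integral_mul_zero {N : ℕ} {a : ℕ → Euc N → ℝ} {ψ : Euc N → ℝ}
    (hψ : Continuous ψ) (hc : HasCompactSupport ψ) {R : ℝ} (hR : tsupport ψ ⊆ closedBall 0 R)
    (h : Tendsto (fun n => eLpNorm (a n) 1 (volume.restrict (closedBall 0 R))) atTop (𝓝 0)) :
    Tendsto (fun n => ∫ x, a n x * ψ x) atTop (𝓝 0) := by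
  obtain ⟨C, hC⟩ := hψ.bounded_above_of_compact_support hc
  rw [tendsto_zero_iff_enorm_tendsto_zero]
  have h2 : Tendsto (fun n => ENNReal.ofReal C *
      eLpNorm (a n) 1 (volume.restrict (closedBall 0 R))) atTop (𝓝 0) := by
    simpa using ENNReal.Tendsto.const_mul h (Or.inr ENNReal.ofReal_ne_top)
  refine tendsto_of_tendsto_of_tendsto_of_le_of_le tendsto_const_nhds h2 (fun _ => zero_le)
    fun n => ?_
  simp only
  rw [eLpNorm_one_eq_lintegral_enorm, ← lintegral_const_mul' _ _ ENNReal.ofReal_ne_top,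
    ← lintegral_indicator measurableSet_closedBall]
  refine (enorm_integral_le_lintegral_enorm _).trans (lintegral_mono fun x => ?_)
  by_cases hx : x ∈ closedBall (0 : Euc N) R
  · rw [indicator_of_mem hx, enorm_mul, mul_comm]
    gcongr
    rw [← ofReal_norm]
    exact ENNReal.ofReal_le_ofReal (hC x)
  · rw [indicator_of_notMem hx, image_eq_zero_of_notMem_tsupport fun h' => hx (hR h')]
    simp

lemma integral_mul_fderiv_of_contDiff {N : ℕ} {w φ : Euc N → ℝ} (hw : ContDiff ℝ 1 w)
    (hφ : ContDiff ℝ 1 φ) (hc : HasCompactSupport φ) (e : Euc N) :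
    ∫ x, w x * fderiv ℝ φ x e = - ∫ x, fderiv ℝ w x e * φ x := by
  have hdφ : Continuous fun x => fderiv ℝ φ x e := (hφ.continuous_fderiv (by simp)).clm_apply
    continuous_const
  have hdw : Continuous fun x => fderiv ℝ w x e := (hw.continuous_fderiv (by simp)).clm_apply
    continuous_const
  have hcd : HasCompactSupport fun x => fderiv ℝ φ x e := hc.fderiv_apply (𝕜 := ℝ) e
  refine integral_mul_fderiv_eq_neg_fderiv_mul_of_integrable ?_ ?_ ?_
    (fun x _ => hw.differentiable (by simp) x) (fun x _ => hφ.differentiable (by simp) x)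
  · exact (hdw.mul hφ.continuous).integrable_of_hasCompactSupport hc.mul_left
  · exact (hw.continuous.mul hdφ).integrable_of_hasCompactSupport hcd.mul_left
  · exact (hw.continuous.mul hφ.continuous).integrable_of_hasCompactSupport hc.mul_left

/-- The weak chain rule for `C¹` functions with bounded derivative, tested form. -/
lemma integral_comp_mul_fderiv_of_bounded {N : ℕ} {i : Fin N} {u v : Euc N → ℝ}
    (h : HasWeakPartial i u v) {F G : ℝ → ℝ} (hF : ∀ t, HasDerivAt F (G t) t) (hG : Continuous G)
    {k : ℝ} (hk : ∀ t, |G t| ≤ k) {φ : Euc N → ℝ} (hφ : ContDiff ℝ ∞ φ)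
    (hc : HasCompactSupport φ) :
    ∫ x, F (u x) * fderiv ℝ φ x (EuclideanSpace.single i 1) = - ∫ x, G (u x) * v x * φ x := by
  obtain ⟨R, hR⟩ := exists_tsupport_subset_closedBall hc
  set e : Euc N := EuclideanSpace.single i 1
  have hdφ : Continuous fun x => fderiv ℝ φ x e := (hφ.continuous_fderiv (by simp)).clm_apply
    continuous_const
  have hcd : HasCompactSupport fun x => fderiv ℝ φ x e := hc.fderiv_apply (𝕜 := ℝ) e
  have hRd : tsupport (fun x => fderiv ℝ φ x e) ⊆ closedBall 0 R :=
    (tsupport_fderiv_apply_subset ℝ e).trans hR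
  have hum := h.1.aestronglyMeasurable
  have hvm := h.2.1.aestronglyMeasurable
  have hFd : Differentiable ℝ F := fun t => (hF t).differentiableAt
  have hF' : deriv F = G := funext fun t => (hF t).deriv
  have hFc : ContDiff ℝ 1 F := contDiff_one_iff_deriv.2 ⟨hFd, hF' ▸ hG⟩
  have hk0 : 0 ≤ k := (abs_nonneg _).trans (hk 0)
  have hLip : ∀ a b, |F a - F b| ≤ k * |a - b| := fun a b => by
    have := Convex.norm_image_sub_le_of_norm_hasDerivWithin_le (f := F) (f' := G) (s := univ)
      (C := k) (x := b) (y := a) (fun x _ => (hF x).hasDerivWithinAt) (fun x _ => hk x)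
      convex_univ (mem_univ _) (mem_univ _)
    simpa using this
  have hun : ∀ n, ContDiff ℝ 1 (mollify n u) := fun n =>
    (mollify_contDiff n h.1).of_le (by simp)
  have hvn : ∀ n, Continuous (mollify n v) := fun n => (mollify_contDiff n h.2.1).continuous
  have hFu : LocallyIntegrable (fun x => F (u x)) volume := by
    have h1 : LocallyIntegrable (fun x => |F 0| + k * |u x|) volume :=
      (locallyIntegrable_const _).add (h.1.norm.smul k)
    refine h1.mono (hFc.continuous.comp_aestronglyMeasurable hum)
      (Eventually.of_forall fun x => ?_)
    have h2 := hLip (u x) 0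
    have h3 := abs_sub_abs_le_abs_sub (F (u x)) (F 0)
    rw [sub_zero] at h2
    rw [Real.norm_eq_abs, Real.norm_eq_abs]
    exact (by linarith : |F (u x)| ≤ |F 0| + k * |u x|).trans (le_abs_self _)
  have hGv : LocallyIntegrable (fun x => G (u x) * v x) volume := by
    refine (h.2.1.norm.smul k).mono ((hG.comp_aestronglyMeasurable hum).mul hvm)
      (Eventually.of_forall fun x => ?_)
    simp only [norm_mul, Real.norm_eq_abs, Pi.smul_apply, smul_eq_mul, abs_abs, abs_of_nonneg hk0]
    gcongr
    exact hk _
  -- left-hand sides converge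
  have hL : Tendsto (fun n => ∫ x, F (mollify n u x) * fderiv ℝ φ x e) atTop
      (𝓝 (∫ x, F (u x) * fderiv ℝ φ x e)) := by
    have h1 : Tendsto (fun n => eLpNorm (fun x => F (mollify n u x) - F (u x)) 1
        (volume.restrict (closedBall 0 R))) atTop (𝓝 0) := by
      have h2 := tendsto_eLpNorm_mollify_sub_closedBall le_rfl (by simp)
        (memLpLoc_one_of_locallyIntegrable h.1) R
      have h3 := ENNReal.Tendsto.const_mul h2
        (Or.inr (ENNReal.ofReal_ne_top (r := k)))
      rw [mul_zero] at h3
      refine tendsto_of_tendsto_of_tendsto_of_le_of_le tendsto_const_nhds h3 (fun _ => zero_le)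
        fun n => ?_
      exact eLpNorm_le_mul_eLpNorm_of_ae_le_mul (Eventually.of_forall fun x => hLip _ _) 1
    refine tendsto_sub_nhds_zero_iff.1
      ((tendsto_integral_mul_zero hdφ hcd hRd h1).congr fun n => ?_)
    rw [← integral_sub]
    · simp [sub_mul]
    · exact LocallyIntegrable.integrable_mul_of_hasCompactSupport
        (hFc.continuous.comp (hun n).continuous).locallyIntegrable hdφ hcd
    · exact hFu.integrable_mul_of_hasCompactSupport hdφ hcd
  have hRt : Tendsto (fun n => ∫ x, G (mollify n u x) * mollify n v x * φ x) atTop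
      (𝓝 (∫ x, G (u x) * v x * φ x)) := by
    -- The product is split because neither factor alone suffices: `v` is approximated in local `L¹`
    -- against the bounded `G`, while `G` of the mollified `u` converges only almost everywhere and
    -- is handled by domination.
    have h1 : Tendsto (fun n => ∫ x, G (mollify n u x) * (mollify n v x - v x) * φ x) atTop
        (𝓝 0) := by
      refine tendsto_integral_mul_zero hφ.continuous hc hR ?_
      have h2 := tendsto_eLpNorm_mollify_sub_closedBall le_rfl (by simp)
        (memLpLoc_one_of_locallyIntegrable h.2.1) R
      have h3 := ENNReal.Tendsto.const_mul h2
        (Or.inr (ENNReal.ofReal_ne_top (r := k)))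
      rw [mul_zero] at h3
      refine tendsto_of_tendsto_of_tendsto_of_le_of_le tendsto_const_nhds h3 (fun _ => zero_le)
        fun n => ?_
      refine eLpNorm_le_mul_eLpNorm_of_ae_le_mul (Eventually.of_forall fun x => ?_) 1
      rw [norm_mul]
      gcongr
      exact hk _
    have h2 : Tendsto (fun n => ∫ x, G (mollify n u x) * v x * φ x) atTop
        (𝓝 (∫ x, G (u x) * v x * φ x)) := by
      refine tendsto_integral_of_dominated_convergence (fun x => k * |v x * φ x|) (fun n => ?_)
        ?_ (fun n => Eventually.of_forall fun x => ?_) ?_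
      · exact ((hG.comp (hun n).continuous).aestronglyMeasurable.mul hvm).mul
          hφ.continuous.aestronglyMeasurable
      · exact (h.2.1.integrable_mul_of_hasCompactSupport hφ.continuous hc).abs.const_mul k
      · rw [mul_assoc, norm_mul, Real.norm_eq_abs, Real.norm_eq_abs]
        gcongr
        exact hk _
      · filter_upwards [mollify_ae_tendsto h.1] with x hx
        exact (((hG.tendsto _).comp hx).mul_const _).mul_const _
    rw [← zero_add (∫ x, G (u x) * v x * φ x)]
    refine (h1.add h2).congr fun n => ?_
    rw [← integral_add]
    · congr 1
      ext x
      ring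
    · have : LocallyIntegrable (fun x => G (mollify n u x) * (mollify n v x - v x)) volume := by
        refine ((((hvn n).locallyIntegrable.sub h.2.1).norm).smul k).mono
          ((hG.comp (hun n).continuous).aestronglyMeasurable.mul
            ((hvn n).aestronglyMeasurable.sub hvm)) (Eventually.of_forall fun x => ?_)
        simp only [norm_mul, Real.norm_eq_abs, Pi.smul_apply, smul_eq_mul, abs_abs,
          abs_of_nonneg hk0, Pi.sub_apply]
        gcongr
        exact hk _
      exact this.integrable_mul_of_hasCompactSupport hφ.continuous hc
    · have : LocallyIntegrable (fun x => G (mollify n u x) * v x) volume := by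
        refine (h.2.1.norm.smul k).mono
          ((hG.comp (hun n).continuous).aestronglyMeasurable.mul hvm)
          (Eventually.of_forall fun x => ?_)
        simp only [norm_mul, Real.norm_eq_abs, Pi.smul_apply, smul_eq_mul, abs_abs,
          abs_of_nonneg hk0]
        gcongr
        exact hk _
      exact this.integrable_mul_of_hasCompactSupport hφ.continuous hc
  refine tendsto_nhds_unique hL (hRt.neg.congr fun n => ?_)
  refine Eq.trans ?_ (integral_mul_fderiv_of_contDiff (hFc.comp (hun n)) (hφ.of_le (by simp))
    hc e).symm
  congr 2
  ext x
  have h1 : HasFDerivAt (F ∘ mollify n u) (G (mollify n u x) • fderiv ℝ (mollify n u) x) x :=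
    (hF _).comp_hasFDerivAt x ((hun n).differentiable (by simp) x).hasFDerivAt
  rw [h1.fderiv]
  simp only [smul_apply, smul_eq_mul]
  rw [fderiv_mollify n h]

/-- Continuity at zero is not visible from the formula when `s < 2`; it comes from `|t| ^ s` being
`C¹`. -/
lemma continuous_rpow_deriv {s : ℝ} (hs : 1 < s) :
    Continuous fun t : ℝ => s * |t| ^ (s - 2) * t := by
  have h1 : ContDiff ℝ 1 fun t : ℝ => ‖t‖ ^ s := contDiff_norm_rpow hs
  have h2 := h1.continuous_deriv le_rfl
  convert h2 using 1
  ext t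
  exact (hasDerivAt_abs_rpow t hs).deriv.symm

lemma abs_rpow_deriv {s : ℝ} (hs : 1 < s) (t : ℝ) :
    |s * |t| ^ (s - 2) * t| = s * |t| ^ (s - 1) := by
  rw [abs_mul, abs_mul, abs_of_pos (by linarith : 0 < s),
    abs_of_nonneg (by positivity : 0 ≤ |t| ^ (s - 2)), mul_assoc]
  rcases eq_or_ne t 0 with rfl | ht
  · simp [Real.zero_rpow (by linarith : s - 1 ≠ 0)]
  · nth_rewrite 2 [← Real.rpow_one |t|]
    rw [← Real.rpow_add (abs_pos.2 ht)]
    ring_nf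

/-- A `C¹` primitive of the truncation at height `k` of the derivative of `|t| ^ s`. -/
lemma exists_truncated_abs_rpow {s : ℝ} (hs : 1 < s) : ∃ F G : ℕ → ℝ → ℝ,
    (∀ k t, HasDerivAt (F k) (G k t) t) ∧ (∀ k, Continuous (G k)) ∧ (∀ k t, |G k t| ≤ k) ∧
    (∀ k t, |G k t| ≤ s * |t| ^ (s - 1)) ∧ (∀ k t, |F k t| ≤ s * |t| ^ s) ∧
    (∀ t, Tendsto (fun k => F k t) atTop (𝓝 (|t| ^ s))) ∧
    (∀ t, Tendsto (fun k => G k t) atTop (𝓝 (s * |t| ^ (s - 2) * t))) := by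
  set g : ℝ → ℝ := fun t => s * |t| ^ (s - 2) * t with hg
  have hgc : Continuous g := continuous_rpow_deriv hs
  have hga : ∀ t, |g t| = s * |t| ^ (s - 1) := abs_rpow_deriv hs
  -- Clamping `g` to `[-k, k]` keeps it continuous and dominated by `|g|`. For fixed `t` it changes
  -- nothing once `k` is large, on the whole segment from `0` to `t`, so both limits are eventually
  -- constant sequences.
  set G : ℕ → ℝ → ℝ := fun k t => max (-(k : ℝ)) (min k (g t)) with hGdef
  have hGc : ∀ k, Continuous (G k) := fun k => by fun_prop
  have hGg : ∀ k t, |G k t| ≤ |g t| := fun k t => by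
    have hk : (0 : ℝ) ≤ k := k.cast_nonneg
    rw [abs_le]
    refine ⟨?_, ?_⟩
    · apply le_max_of_le_right
      exact le_min ((neg_nonpos.2 (abs_nonneg _)).trans hk) (neg_abs_le _)
    · exact max_le ((neg_nonpos.2 hk).trans (abs_nonneg _))
        ((min_le_right _ _).trans (le_abs_self _))
  have hGe : ∀ (k : ℕ) t, |g t| ≤ k → G k t = g t := fun k t h => by
    rw [abs_le] at h
    simp only [hGdef]
    rw [min_eq_right h.2, max_eq_right h.1]
  refine ⟨fun k t => ∫ τ in (0 : ℝ)..t, G k τ, G, fun k t => ?_, hGc, fun k t => ?_,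
    fun k t => (hGg k t).trans (hga t).le, fun k t => ?_, fun t => ?_, fun t => ?_⟩
  · exact intervalIntegral.integral_hasDerivAt_right ((hGc k).intervalIntegrable _ _)
      ((hGc k).stronglyMeasurableAtFilter _ _) (hGc k).continuousAt
  · have hk : (0 : ℝ) ≤ k := k.cast_nonneg
    rw [abs_le]
    exact ⟨le_max_left _ _, max_le (by linarith) (min_le_left _ _)⟩
  · have h1 : ‖∫ τ in (0 : ℝ)..t, G k τ‖ ≤ s * |t| ^ (s - 1) * |t - 0| := by
      apply intervalIntegral.norm_integral_le_of_norm_le_const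
      intro τ hτ
      refine (hGg k τ).trans ((hga τ).le.trans ?_)
      have : |τ| ≤ |t| := by
        rw [uIoc_eq_union] at hτ
        rcases hτ with hτ | hτ
        · rw [abs_of_pos hτ.1]; exact hτ.2.trans (le_abs_self _)
        · rw [abs_of_nonpos hτ.2]
          exact (by linarith [hτ.1] : -τ ≤ -t).trans (neg_le_abs t)
      gcongr
    rw [sub_zero] at h1
    refine h1.trans (le_of_eq ?_)
    rcases eq_or_ne t 0 with rfl | ht
    · simp [Real.zero_rpow (by linarith : s ≠ 0)]
    · nth_rewrite 2 [← Real.rpow_one |t|]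
      rw [mul_assoc, ← Real.rpow_add (abs_pos.2 ht)]
      ring_nf
  · obtain ⟨k0, hk0⟩ := exists_nat_ge (s * |t| ^ (s - 1))
    refine tendsto_const_nhds.congr' ?_
    filter_upwards [eventually_ge_atTop k0] with k hk
    have h1 : ∫ τ in (0 : ℝ)..t, G k τ = ∫ τ in (0 : ℝ)..t, g τ := by
      apply intervalIntegral.integral_congr
      intro τ hτ
      apply hGe
      rw [hga]
      have : |τ| ≤ |t| := by
        rw [mem_uIcc] at hτ
        rcases hτ with hτ | hτ
        · rw [abs_of_nonneg hτ.1]; exact hτ.2.trans (le_abs_self _)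
        · rw [abs_of_nonpos hτ.2]
          exact (by linarith [hτ.1] : -τ ≤ -t).trans (neg_le_abs t)
      calc s * |τ| ^ (s - 1) ≤ s * |t| ^ (s - 1) := by gcongr
        _ ≤ k0 := hk0
        _ ≤ k := by exact_mod_cast hk
    rw [h1, intervalIntegral.integral_eq_sub_of_hasDerivAt (f := fun t : ℝ => |t| ^ s)
      (fun τ _ => hasDerivAt_abs_rpow τ hs) (hgc.intervalIntegrable _ _)]
    simp [Real.zero_rpow (by linarith : s ≠ 0)]
  · obtain ⟨k0, hk0⟩ := exists_nat_ge |g t|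
    refine tendsto_const_nhds.congr' ?_
    filter_upwards [eventually_ge_atTop k0] with k hk
    exact (hGe k t (hk0.trans (by exact_mod_cast hk))).symm

/-- A Young inequality without sharp constants, by comparing `a` and `b`. It dominates `|u|^(s-1)
|∂u|` using only local `L^s` bounds. -/
lemma rpow_mul_le_add {s a b : ℝ} (hs : 1 < s) (ha : 0 ≤ a) (hb : 0 ≤ b) :
    a ^ (s - 1) * b ≤ a ^ s + b ^ s := by
  have key : ∀ c : ℝ, 0 ≤ c → c ^ (s - 1) * c = c ^ s := fun c hc => by
    rcases hc.eq_or_lt with rfl | hc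
    · simp [Real.zero_rpow (by linarith : s ≠ 0)]
    · nth_rewrite 2 [← Real.rpow_one c]
      rw [← Real.rpow_add hc]; ring_nf
  rcases le_total a b with h | h
  · calc a ^ (s - 1) * b ≤ b ^ (s - 1) * b := by gcongr
      _ = b ^ s := key b hb
      _ ≤ _ := by linarith [Real.rpow_nonneg ha s]
  · calc a ^ (s - 1) * b ≤ a ^ (s - 1) * a := by gcongr
      _ = a ^ s := key a ha
      _ ≤ _ := by linarith [Real.rpow_nonneg hb s]

lemma MemLpLoc.locallyIntegrable_abs_rpow {N : ℕ} {s : ℝ} (hs : 0 < s) {u : Euc N → ℝ}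
    (hu : MemLpLoc (ENNReal.ofReal s) u) : LocallyIntegrable (fun x => |u x| ^ s) volume := by
  rw [locallyIntegrable_iff]
  intro K hK
  have := (hu K hK).integrable_norm_rpow (by simpa using hs) ENNReal.ofReal_ne_top
  rwa [ENNReal.toReal_ofReal hs.le] at this

/-- The weak chain rule for `|u| ^ s`. -/
lemma HasWeakPartial.abs_rpow {N : ℕ} {i : Fin N} {u v : Euc N → ℝ} {s : ℝ} (hs : 1 < s)
    (h : HasWeakPartial i u v) (hu : MemLpLoc (ENNReal.ofReal s) u)
    (hv : MemLpLoc (ENNReal.ofReal s) v) :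
    HasWeakPartial i (fun x => |u x| ^ s) (fun x => s * |u x| ^ (s - 2) * u x * v x) := by
  have hum := h.1.aestronglyMeasurable
  have hvm := h.2.1.aestronglyMeasurable
  have hus := hu.locallyIntegrable_abs_rpow (by linarith)
  have hvs := hv.locallyIntegrable_abs_rpow (by linarith)
  have hdom : LocallyIntegrable (fun x => s * (|u x| ^ s + |v x| ^ s)) volume :=
    (hus.add hvs).smul s
  have hle : ∀ x, s * |u x| ^ (s - 1) * |v x| ≤ s * (|u x| ^ s + |v x| ^ s) := fun x => by
    rw [mul_assoc]
    gcongr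
    exact rpow_mul_le_add hs (abs_nonneg _) (abs_nonneg _)
  refine ⟨hus, ?_, fun φ hφ hc => ?_⟩
  · refine hdom.mono (((continuous_rpow_deriv hs).comp_aestronglyMeasurable hum).mul hvm)
      (Eventually.of_forall fun x => ?_)
    rw [norm_mul, Real.norm_eq_abs, Real.norm_eq_abs, abs_rpow_deriv hs]
    exact (hle x).trans (le_abs_self _)
  -- The chain rule holds for each truncation, whose derivative is bounded. The bounds uniform in
  -- `k` then allow dominated convergence on both sides.
  · obtain ⟨F, G, hFG, hGc, hGk, hGb, hFb, hFt, hGt⟩ := exists_truncated_abs_rpow hs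
    have hFc : ∀ k, Continuous (F k) := fun k =>
      continuous_iff_continuousAt.2 fun t => (hFG k t).continuousAt
    have heq := fun k => integral_comp_mul_fderiv_of_bounded h (hFG k) (hGc k) (hGk k) hφ hc
    have hdφ : Continuous fun x => fderiv ℝ φ x (EuclideanSpace.single i 1) :=
      (hφ.continuous_fderiv (by simp)).clm_apply continuous_const
    have hcd : HasCompactSupport fun x => fderiv ℝ φ x (EuclideanSpace.single i 1) :=
      hc.fderiv_apply (𝕜 := ℝ) _
    have hL : Tendsto (fun k => ∫ x, F k (u x) * fderiv ℝ φ x (EuclideanSpace.single i 1)) atTop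
        (𝓝 (∫ x, |u x| ^ s * fderiv ℝ φ x (EuclideanSpace.single i 1))) := by
      refine tendsto_integral_of_dominated_convergence
        (fun x => s * |(|u x| ^ s) * fderiv ℝ φ x (EuclideanSpace.single i 1)|) (fun k => ?_) ?_
        (fun k => Eventually.of_forall fun x => ?_) (Eventually.of_forall fun x => ?_)
      · exact ((hFc k).comp_aestronglyMeasurable hum).mul hdφ.aestronglyMeasurable
      · exact (hus.integrable_mul_of_hasCompactSupport hdφ hcd).abs.const_mul s
      · rw [norm_mul, abs_mul, abs_of_nonneg (by positivity : 0 ≤ |u x| ^ s), ← mul_assoc]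
        gcongr
        · exact hFb k _
        · exact le_rfl
      · exact (hFt _).mul_const _
    have hR : Tendsto (fun k => ∫ x, G k (u x) * v x * φ x) atTop
        (𝓝 (∫ x, s * |u x| ^ (s - 2) * u x * v x * φ x)) := by
      refine tendsto_integral_of_dominated_convergence
        (fun x => |s * (|u x| ^ s + |v x| ^ s) * φ x|) (fun k => ?_) ?_
        (fun k => Eventually.of_forall fun x => ?_) (Eventually.of_forall fun x => ?_)
      · exact (((hGc k).comp_aestronglyMeasurable hum).mul hvm).mul
          hφ.continuous.aestronglyMeasurable
      · exact (hdom.integrable_mul_of_hasCompactSupport hφ.continuous hc).abs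
      · rw [norm_mul, norm_mul, abs_mul]
        simp only [Real.norm_eq_abs]
        gcongr
        refine le_trans ?_ ((hle x).trans (le_abs_self _))
        gcongr
        exact hGb k _
      · exact ((hGt _).mul_const _).mul_const _
    refine tendsto_nhds_unique hL (hR.neg.congr fun k => (heq k).symm)

/-! ### Uniqueness of weak derivatives and symmetry of second ones. -/

lemma HasWeakPartial.ae_eq {N : ℕ} {i : Fin N} {u v w : Euc N → ℝ} (hv : HasWeakPartial i u v)
    (hw : HasWeakPartial i u w) : v =ᵐ[volume] w := by
  refine ae_eq_of_integral_contDiff_smul_eq hv.2.1 hw.2.1 fun φ hφ hc => ?_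
  have h1 := hv.2.2 φ hφ hc
  rw [hw.2.2 φ hφ hc, neg_inj] at h1
  simpa [mul_comm] using h1.symm

lemma HasWeakPartial.congr_left {N : ℕ} {i : Fin N} {u u' v : Euc N → ℝ}
    (h : HasWeakPartial i u v) (hu : u =ᵐ[volume] u') : HasWeakPartial i u' v := by
  refine ⟨fun x => (h.1 x).congr hu, h.2.1, fun φ hφ hc => ?_⟩
  rw [← h.2.2 φ hφ hc]
  apply integral_congr_ae
  filter_upwards [hu] with x hx
  rw [hx]

/-- Mollified second weak derivatives are symmetric. -/
lemma mollify_second_partial_symm {N : ℕ} (n : ℕ) {i j : Fin N} {u gi gj wij wji : Euc N → ℝ}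
    (hi : HasWeakPartial i u gi) (hj : HasWeakPartial j u gj) (hij : HasWeakPartial j gi wij)
    (hji : HasWeakPartial i gj wji) : mollify n wij = mollify n wji := by
  have hu := mollify_contDiff n hi.1
  have key : ∀ {a b : Fin N} {ga wab : Euc N → ℝ}, HasWeakPartial a u ga → HasWeakPartial b ga wab →
      ∀ x, mollify n wab x = fderiv ℝ (fderiv ℝ (mollify n u)) x (EuclideanSpace.single b 1)
        (EuclideanSpace.single a 1) := by
    intro a b ga wab ha hab x
    rw [← fderiv_mollify n hab]
    have h1 : mollify n ga = fun y => fderiv ℝ (mollify n u) y (EuclideanSpace.single a 1) :=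
      funext fun y => (fderiv_mollify n ha y).symm
    have h2 : DifferentiableAt ℝ (fderiv ℝ (mollify n u)) x :=
      (hu.fderiv_right (m := 1) (by norm_cast)).differentiable (by simp) x
    rw [h1, fderiv_clm_apply h2 (differentiableAt_const _)]
    simp
  ext x
  rw [key hi hij, key hj hji]
  have hsymm : IsSymmSndFDerivAt ℝ (mollify n u) x :=
    hu.contDiffAt.isSymmSndFDerivAt (by
      simp only [minSmoothness_of_isRCLikeNormedField]
      exact WithTop.coe_le_coe.2 le_top)
  exact hsymm _ _

/-! ### Testing the local terms with the dilation field. -/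

lemma fderiv_apply_eq_sum {N : ℕ} (L : Euc N →L[ℝ] ℝ) (v : Euc N) :
    L v = ∑ i, v i * L (EuclideanSpace.single i 1) := by
  conv_lhs => rw [← (EuclideanSpace.basisFun (Fin N) ℝ).sum_repr v]
  simp

lemma inner_eq_sum {N : ℕ} (v w : Euc N) : inner ℝ v w = ∑ i, w i * v i := by
  simp [PiLp.inner_apply]

/-- Integration by parts against the dilation field. -/
lemma HasWeakGradient.integral_mul_inner_self {N : ℕ} {f : Euc N → ℝ} {h : Euc N → Euc N}
    (hf : HasWeakGradient f h) {ψ : Euc N → ℝ} (hψ : ContDiff ℝ ∞ ψ) (hc : HasCompactSupport ψ) :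
    ∫ x, ψ x * inner ℝ (h x) x = - ∫ x, f x * (N * ψ x + fderiv ℝ ψ x x) := by
  have hsm : ∀ i : Fin N, ContDiff ℝ ∞ fun x : Euc N => ψ x * x i := fun i => by fun_prop
  have hcs : ∀ i : Fin N, HasCompactSupport fun x : Euc N => ψ x * x i := fun i => hc.mul_right
  have hint1 : ∀ i : Fin N, Integrable (fun x => h x i * (ψ x * x i)) volume := fun i =>
    (hf i).2.1.integrable_mul_of_hasCompactSupport (hsm i).continuous (hcs i)
  have hint2 : ∀ i : Fin N, Integrable (fun x => f x *
      fderiv ℝ (fun x : Euc N => ψ x * x i) x (EuclideanSpace.single i 1)) volume := fun i =>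
    (hf i).1.integrable_mul_of_hasCompactSupport
      (((hsm i).continuous_fderiv (by simp)).clm_apply continuous_const)
      ((hcs i).fderiv_apply (𝕜 := ℝ) _)
  have hd : ∀ (i : Fin N) (x : Euc N),
      fderiv ℝ (fun x : Euc N => ψ x * x i) x (EuclideanSpace.single i 1) =
        x i * fderiv ℝ ψ x (EuclideanSpace.single i 1) + ψ x := fun i x => by
    have h1 : HasFDerivAt (fun x : Euc N => x i) (EuclideanSpace.proj i : Euc N →L[ℝ] ℝ) x :=
      (EuclideanSpace.proj i : Euc N →L[ℝ] ℝ).hasFDerivAt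
    have h2 : HasFDerivAt ψ (fderiv ℝ ψ x) x := (hψ.differentiable (by simp) x).hasFDerivAt
    have h3 : HasFDerivAt (fun x : Euc N => ψ x * x i) _ x := h2.mul h1
    rw [h3.fderiv]
    simp [add_comm]
  calc ∫ x, ψ x * inner ℝ (h x) x = ∫ x, ∑ i, h x i * (ψ x * x i) := by
        congr 1; ext x
        rw [inner_eq_sum, Finset.mul_sum]
        exact Finset.sum_congr rfl fun i _ => by ring
    _ = ∑ i, ∫ x, h x i * (ψ x * x i) := integral_finsetSum _ fun i _ => hint1 i
    _ = ∑ i, - ∫ x, f x * fderiv ℝ (fun x : Euc N => ψ x * x i) x (EuclideanSpace.single i 1) :=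
        Finset.sum_congr rfl fun i _ => by
          rw [(hf i).2.2 _ (hsm i) (hcs i), neg_neg]
    _ = - ∫ x, ∑ i, f x *
          fderiv ℝ (fun x : Euc N => ψ x * x i) x (EuclideanSpace.single i 1) := by
        rw [integral_finsetSum _ fun i _ => hint2 i, Finset.sum_neg_distrib]
    _ = _ := by
        congr 2; ext x
        simp_rw [hd]
        rw [← Finset.mul_sum, Finset.sum_add_distrib, ← fderiv_apply_eq_sum]
        simp [add_comm]

lemma MemLpLoc.locallyIntegrable_mul {N : ℕ} {a c : Euc N → ℝ} (ha : MemLpLoc 2 a)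
    (hc : MemLpLoc 2 c) : LocallyIntegrable (fun x => a x * c x) volume := by
  rw [locallyIntegrable_iff]
  intro K hK
  exact (ha K hK).integrable_mul (hc K hK)

lemma memLpLoc_of_continuous {N : ℕ} {q : ℝ≥0∞} {v : Euc N → ℝ} (hv : Continuous v) :
    MemLpLoc q v := by
  intro K hK
  obtain ⟨C, hC⟩ := hK.exists_bound_of_continuousOn hv.continuousOn
  have : IsFiniteMeasure ((volume : Measure (Euc N)).restrict K) :=
    isFiniteMeasure_restrict.2 hK.measure_ne_top
  refine MemLp.of_bound hv.aestronglyMeasurable C ?_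
  filter_upwards [ae_restrict_mem hK.measurableSet] with x hx using hC x hx

lemma tendsto_integral_mul_mul_mollify {N : ℕ} {a c b : Euc N → ℝ} (ha : MemLpLoc 2 a)
    (hc : MemLpLoc 2 c) (hcl : LocallyIntegrable c volume) (hb : Continuous b)
    (hbc : HasCompactSupport b) :
    Tendsto (fun n => ∫ x, a x * mollify n c x * b x) atTop (𝓝 (∫ x, a x * c x * b x)) := by
  obtain ⟨R, hR⟩ := exists_tsupport_subset_closedBall hbc
  have hmol : ∀ n, MemLpLoc 2 (mollify n c) := fun n K hK =>
    memLpLoc_of_continuous (mollify_contDiff n hcl).continuous K hK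
  have haR := ha _ (isCompact_closedBall (0 : Euc N) R)
  have h1 : Tendsto (fun n => eLpNorm (fun x => a x * (mollify n c x - c x)) 1
      (volume.restrict (closedBall 0 R))) atTop (𝓝 0) := by
    have h2 := tendsto_eLpNorm_mollify_sub_closedBall (by norm_num) (by simp) hc R
    have h3 := ENNReal.Tendsto.const_mul h2 (Or.inr haR.2.ne)
    rw [mul_zero] at h3
    refine tendsto_of_tendsto_of_tendsto_of_le_of_le tendsto_const_nhds h3 (fun _ => zero_le)
      fun n => ?_
    have hm : AEStronglyMeasurable (fun x => mollify n c x - c x)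
        (volume.restrict (closedBall 0 R)) :=
      ((mollify_contDiff n hcl).continuous.aestronglyMeasurable.sub
        hcl.aestronglyMeasurable).restrict
    have h4 : eLpNorm (a • fun x => mollify n c x - c x) 1 (volume.restrict (closedBall 0 R)) ≤ _ :=
      eLpNorm_smul_le_mul_eLpNorm (p := 2) (q := 2) (r := 1) hm haR.1
    exact h4
  refine tendsto_sub_nhds_zero_iff.1 ((tendsto_integral_mul_zero hb hbc hR h1).congr fun n => ?_)
  rw [← integral_sub]
  · congr 1; ext x; ring
  · exact (ha.locallyIntegrable_mul (hmol n)).integrable_mul_of_hasCompactSupport hb hbc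
  · exact (ha.locallyIntegrable_mul hc).integrable_mul_of_hasCompactSupport hb hbc

lemma HasWeakPartial.sq {N : ℕ} {i : Fin N} {u v : Euc N → ℝ} (h : HasWeakPartial i u v)
    (hu : MemLpLoc 2 u) (hv : MemLpLoc 2 v) :
    HasWeakPartial i (fun x => u x ^ 2) (fun x => 2 * u x * v x) := by
  have h2 : ENNReal.ofReal 2 = 2 := by simp
  have := h.abs_rpow (s := 2) (by norm_num) (h2.symm ▸ hu) (h2.symm ▸ hv)
  simpa using this

/-- Integration by parts of `u ∇u` against the dilation field. -/
lemma HasWeakGradient.integral_mul_mul_inner_self {N : ℕ} {u : Euc N → ℝ} {g : Euc N → Euc N}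
    (h : HasWeakGradient u g) (hu : MemLpLoc 2 u) (hg : ∀ i, MemLpLoc 2 fun x => g x i)
    {η : Euc N → ℝ} (hη : ContDiff ℝ ∞ η) (hc : HasCompactSupport η) :
    ∫ x, η x * u x * inner ℝ (g x) x =
      - (1 / 2) * ∫ x, u x ^ 2 * (N * η x + fderiv ℝ η x x) := by
  have h2 : HasWeakGradient (fun x => u x ^ 2) (fun x => (2 * u x) • g x) := fun i => by
    simpa using (h i).sq hu (hg i)
  have h3 := h2.integral_mul_inner_self hη hc
  have h4 : ∫ x, η x * inner ℝ ((2 * u x) • g x) x = 2 * ∫ x, η x * u x * inner ℝ (g x) x := by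
    rw [← integral_const_mul]
    congr 1; ext x
    rw [real_inner_smul_left]; ring
  linarith

/-- The test function obtained from the mollified derivative of `u` along the dilation field. -/
noncomputable def dilationTest {N : ℕ} (η : Euc N → ℝ) (g : Euc N → Euc N) (n : ℕ) (x : Euc N) :
    ℝ :=
  η x * ∑ i, x i * mollify n (fun y => g y i) x

lemma dilationTest_contDiff {N : ℕ} {η : Euc N → ℝ} {g : Euc N → Euc N} (n : ℕ)
    (hη : ContDiff ℝ ∞ η) (hg : ∀ i, LocallyIntegrable (fun x => g x i) volume) :
    ContDiff ℝ ∞ (dilationTest η g n) := by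
  have := fun i => mollify_contDiff n (hg i)
  unfold dilationTest
  fun_prop

lemma dilationTest_hasCompactSupport {N : ℕ} {η : Euc N → ℝ} {g : Euc N → Euc N} (n : ℕ)
    (hc : HasCompactSupport η) : HasCompactSupport (dilationTest η g n) :=
  hc.mul_right

lemma fderiv_dilationTest {N : ℕ} {η : Euc N → ℝ} {g : Euc N → Euc N} (n : ℕ)
    (hη : ContDiff ℝ ∞ η) (hg : ∀ i, LocallyIntegrable (fun x => g x i) volume) (x v : Euc N) :
    fderiv ℝ (dilationTest η g n) x v =
      (∑ i, fderiv ℝ η x v * x i * mollify n (fun y => g y i) x) +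
      (∑ i, η x * v i * mollify n (fun y => g y i) x) +
      ∑ i, η x * x i * fderiv ℝ (mollify n (fun y => g y i)) x v := by
  have h1 : HasFDerivAt η (fderiv ℝ η x) x := (hη.differentiable (by simp) x).hasFDerivAt
  have h2 : ∀ i, HasFDerivAt (fun x : Euc N => x i * mollify n (fun y => g y i) x)
      (x i • fderiv ℝ (mollify n (fun y => g y i)) x +
        mollify n (fun y => g y i) x • (EuclideanSpace.proj i : Euc N →L[ℝ] ℝ)) x := fun i =>
    ((EuclideanSpace.proj i : Euc N →L[ℝ] ℝ).hasFDerivAt (x := x)).mul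
      ((mollify_contDiff n (hg i)).differentiable (by simp) x).hasFDerivAt
  have h3 : HasFDerivAt (dilationTest η g n) _ x :=
    h1.mul (HasFDerivAt.fun_sum fun i (_ : i ∈ Finset.univ) => h2 i)
  have hproj : ∀ i, (EuclideanSpace.proj i : Euc N →L[ℝ] ℝ) v = v i := fun _ => rfl
  rw [h3.fderiv]
  simp only [add_apply, smul_apply, sum_apply, smul_eq_mul,
    hproj, Finset.sum_add_distrib, Finset.sum_mul, mul_add, Finset.mul_sum]
  have e1 : ∀ i, η x * (x i * fderiv ℝ (mollify n fun y => g y i) x v) =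
    η x * x i * fderiv ℝ (mollify n fun y => g y i) x v := fun i => by ring
  have e2 : ∀ i, η x * (mollify n (fun y => g y i) x * v i) =
    η x * v i * mollify n (fun y => g y i) x := fun i => by ring
  have e3 : ∀ i, x i * mollify n (fun y => g y i) x * fderiv ℝ η x v =
    fderiv ℝ η x v * x i * mollify n (fun y => g y i) x := fun i => by ring
  simp_rw [e1, e2, e3]
  ring

lemma inner_gradient {N : ℕ} (φ : Euc N → ℝ) (x v : Euc N) :
    inner ℝ v (gradient φ x) = fderiv ℝ φ x v := by
  rw [real_inner_comm, gradient, InnerProductSpace.toDual_symm_apply]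

/-- The mollified gradient converges in local `L²`, and the limit `∫ η u ∇u · x` is an integral of
`½ ∇(u²) · x`. -/
lemma tendsto_integral_mul_dilationTest {N : ℕ} {u : Euc N → ℝ} {g : Euc N → Euc N}
    (h : HasWeakGradient u g) (hu : MemLpLoc 2 u) (hg : ∀ i, MemLpLoc 2 fun x => g x i)
    {η : Euc N → ℝ} (hη : ContDiff ℝ ∞ η) (hc : HasCompactSupport η) :
    Tendsto (fun n => ∫ x, u x * dilationTest η g n x) atTop
      (𝓝 (- (1 / 2) * ∫ x, u x ^ 2 * (N * η x + fderiv ℝ η x x))) := by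
  have hb : ∀ i : Fin N, Continuous fun x : Euc N => η x * x i := fun i =>
    hη.continuous.mul (by fun_prop)
  have hbc : ∀ i : Fin N, HasCompactSupport fun x : Euc N => η x * x i := fun i => hc.mul_right
  have hlim := tendsto_finsetSum Finset.univ fun i (_ : i ∈ Finset.univ) =>
    tendsto_integral_mul_mul_mollify hu (hg i) (h i).2.1 (hb i) (hbc i)
  rw [← h.integral_mul_mul_inner_self hu hg hη hc]
  have e1 : ∑ i, ∫ x, u x * g x i * (η x * x i) = ∫ x, η x * u x * inner ℝ (g x) x := by
    rw [← integral_finsetSum _ fun i _ => (hu.locallyIntegrable_mul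
      (hg i)).integrable_mul_of_hasCompactSupport (hb i) (hbc i)]
    congr 1; ext x
    rw [inner_eq_sum, Finset.mul_sum]
    exact Finset.sum_congr rfl fun i _ => by ring
  rw [← e1]
  refine hlim.congr fun n => ?_
  rw [← integral_finsetSum _ fun i _ => (hu.locallyIntegrable_mul (memLpLoc_of_continuous
    (mollify_contDiff n (h i).2.1).continuous)).integrable_mul_of_hasCompactSupport (hb i) (hbc i)]
  congr 1; ext x
  rw [dilationTest, Finset.mul_sum, Finset.mul_sum]
  exact Finset.sum_congr rfl fun i _ => by ring

/-- Differentiating the test function produces a term with `∇η`, a term `η ∇u` from the derivative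
of `x`, and a Hessian term. Each is a sum of products of a fixed `L²_loc` function with a mollified
one. In the limit the Hessian term is `½ η x · ∇|∇u|²`, which accounts for the divergence `N η + ∇η
· x` of the field `η x`. -/
lemma tendsto_integral_inner_gradient_dilationTest {N : ℕ} {u : Euc N → ℝ} {g : Euc N → Euc N}
    {w : Fin N → Euc N → Euc N} (h : HasWeakGradient u g) (hg : ∀ i, MemLpLoc 2 fun x => g x i)
    (hw : ∀ j, HasWeakGradient (fun x => g x j) (w j)) (hwL : ∀ j i, MemLpLoc 2 fun x => w j x i)
    {η : Euc N → ℝ} (hη : ContDiff ℝ ∞ η) (hc : HasCompactSupport η) :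
    Tendsto (fun n => ∫ x, inner ℝ (g x) (gradient (dilationTest η g n) x)) atTop
      (𝓝 ((∫ x, fderiv ℝ η x (g x) * inner ℝ (g x) x) + (∫ x, η x * ‖g x‖ ^ 2) -
        (1 / 2) * ∫ x, ‖g x‖ ^ 2 * (N * η x + fderiv ℝ η x x))) := by
  set e : Fin N → Euc N := fun j => EuclideanSpace.single j 1
  have hgl : ∀ i, LocallyIntegrable (fun x => g x i) volume := fun i => (h i).2.1
  have hwl : ∀ j i, LocallyIntegrable (fun x => w j x i) volume := fun j i => (hw j i).2.1
  have hb1 : ∀ i j : Fin N, Continuous fun x : Euc N => fderiv ℝ η x (e j) * x i := fun i j =>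
    ((hη.continuous_fderiv (by simp)).clm_apply continuous_const).mul (by fun_prop)
  have hbc1 : ∀ i j : Fin N, HasCompactSupport fun x : Euc N => fderiv ℝ η x (e j) * x i :=
    fun i j => (hc.fderiv_apply (𝕜 := ℝ) _).mul_right
  have hb3 : ∀ i : Fin N, Continuous fun x : Euc N => η x * x i := fun i =>
    hη.continuous.mul (by fun_prop)
  have hbc3 : ∀ i : Fin N, HasCompactSupport fun x : Euc N => η x * x i := fun i => hc.mul_right
  have hmL : ∀ {v : Euc N → ℝ}, LocallyIntegrable v volume → ∀ n, MemLpLoc 2 (mollify n v) :=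
    fun hv n => memLpLoc_of_continuous (mollify_contDiff n hv).continuous
  have hpt : ∀ n x, inner ℝ (g x) (gradient (dilationTest η g n) x) =
      (∑ j, ∑ i, g x j * mollify n (fun y => g y i) x * (fderiv ℝ η x (e j) * x i)) +
      (∑ i, g x i * mollify n (fun y => g y i) x * η x) +
      ∑ j, ∑ i, g x j * mollify n (fun y => w j y i) x * (η x * x i) := by
    intro n x
    rw [inner_gradient, fderiv_dilationTest n hη hgl]
    congr 1
    · congr 1
      · rw [Finset.sum_comm]
        refine Finset.sum_congr rfl fun i _ => ?_
        rw [fderiv_apply_eq_sum (fderiv ℝ η x), Finset.sum_mul, Finset.sum_mul]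
        exact Finset.sum_congr rfl fun j _ => by ring
      · exact Finset.sum_congr rfl fun j _ => by ring
    · rw [Finset.sum_comm]
      refine Finset.sum_congr rfl fun i _ => ?_
      rw [fderiv_apply_eq_sum (fderiv ℝ (mollify n fun y => g y i) x), Finset.mul_sum]
      refine Finset.sum_congr rfl fun j _ => ?_
      -- Symmetry is applied after mollification, where the derivatives are classical. It brings the
      -- derivative of `g_j` next to the factor `g_j`, as needed for the square.
      rw [fderiv_mollify n (hw i j),
        mollify_second_partial_symm n (h i) (h j) (hw i j) (hw j i)]
      ring
  have l1 := tendsto_finsetSum Finset.univ fun j (_ : j ∈ Finset.univ) =>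
    tendsto_finsetSum Finset.univ fun i (_ : i ∈ Finset.univ) =>
    tendsto_integral_mul_mul_mollify (hg j) (hg i) (hgl i) (hb1 i j) (hbc1 i j)
  have l2 := tendsto_finsetSum Finset.univ fun i (_ : i ∈ Finset.univ) =>
    tendsto_integral_mul_mul_mollify (hg i) (hg i) (hgl i) hη.continuous hc
  have l3 := tendsto_finsetSum Finset.univ fun j (_ : j ∈ Finset.univ) =>
    tendsto_finsetSum Finset.univ fun i (_ : i ∈ Finset.univ) =>
    tendsto_integral_mul_mul_mollify (hg j) (hwL j i) (hwl j i) (hb3 i) (hbc3 i)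
  have i1 : ∀ {a c : Euc N → ℝ}, MemLpLoc 2 a → MemLpLoc 2 c → ∀ {b : Euc N → ℝ},
      Continuous b → HasCompactSupport b → Integrable (fun x => a x * c x * b x) volume :=
    fun ha hc' _ hb hbc => (ha.locallyIntegrable_mul hc').integrable_mul_of_hasCompactSupport hb hbc
  have e1 : ∑ j, ∑ i, ∫ x, g x j * g x i * (fderiv ℝ η x (e j) * x i) =
      ∫ x, fderiv ℝ η x (g x) * inner ℝ (g x) x := by
    rw [show (∫ x, fderiv ℝ η x (g x) * inner ℝ (g x) x) =
        ∫ x, ∑ j, ∑ i, g x j * g x i * (fderiv ℝ η x (e j) * x i) by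
      congr 1; ext x
      rw [inner_eq_sum, fderiv_apply_eq_sum (fderiv ℝ η x), Finset.sum_mul_sum]
      exact Finset.sum_congr rfl fun j _ => Finset.sum_congr rfl fun i _ => by ring]
    rw [integral_finsetSum _ fun j _ => integrable_finsetSum _ fun i _ =>
      i1 (hg j) (hg i) (hb1 i j) (hbc1 i j)]
    refine Finset.sum_congr rfl fun j _ => ?_
    rw [integral_finsetSum _ fun i _ => i1 (hg j) (hg i) (hb1 i j) (hbc1 i j)]
  have hnorm : ∀ x, ‖g x‖ ^ 2 = ∑ i, g x i ^ 2 := fun x => EuclideanSpace.real_norm_sq_eq (g x)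
  have e2 : ∑ i, ∫ x, g x i * g x i * η x = ∫ x, η x * ‖g x‖ ^ 2 := by
    rw [← integral_finsetSum _ fun i _ => i1 (hg i) (hg i) hη.continuous hc]
    congr 1; ext x
    rw [hnorm, Finset.mul_sum]
    exact Finset.sum_congr rfl fun j _ => by ring
  have hbN : Continuous fun x : Euc N => N * η x + fderiv ℝ η x x :=
    (continuous_const.mul hη.continuous).add ((hη.continuous_fderiv (by simp)).clm_apply
      continuous_id)
  have hbNc : HasCompactSupport fun x : Euc N => N * η x + fderiv ℝ η x x :=
    hc.mul_left.add ((hc.fderiv (𝕜 := ℝ)).mono fun x hx => by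
      contrapose! hx
      simp only [Function.mem_support, ne_eq, not_not] at hx ⊢
      simp [hx])
  have e3 : ∑ j, ∑ i, ∫ x, g x j * w j x i * (η x * x i) =
      - ((1 / 2) * ∫ x, ‖g x‖ ^ 2 * (N * η x + fderiv ℝ η x x)) := by
    have e4 : ∀ j, ∑ i, ∫ x, g x j * w j x i * (η x * x i) =
        - (1 / 2) * ∫ x, g x j ^ 2 * (N * η x + fderiv ℝ η x x) := fun j => by
      rw [← (hw j).integral_mul_mul_inner_self (hg j) (hwL j) hη hc,
        ← integral_finsetSum _ fun i _ => i1 (hg j) (hwL j i) (hb3 i) (hbc3 i)]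
      congr 1; ext x
      rw [inner_eq_sum, Finset.mul_sum]
      exact Finset.sum_congr rfl fun i _ => by ring
    simp_rw [e4]
    rw [← Finset.mul_sum, ← integral_finsetSum _ fun j _ => by
      simp_rw [sq]
      exact i1 (hg j) (hg j) hbN hbNc]
    rw [← neg_mul]
    congr 2; ext x
    rw [hnorm, Finset.sum_mul]
  rw [sub_eq_add_neg, ← e1, ← e2, ← e3]
  refine ((l1.add l2).add l3).congr fun n => ?_
  simp_rw [hpt]
  have j1 : ∀ j, Integrable (fun x => ∑ i, g x j * mollify n (fun y => g y i) x *
      (fderiv ℝ η x (e j) * x i)) volume := fun j => integrable_finsetSum _ fun i _ =>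
    i1 (hg j) (hmL (hgl i) n) (hb1 i j) (hbc1 i j)
  have j2 : Integrable (fun x => ∑ i, g x i * mollify n (fun y => g y i) x * η x) volume :=
    integrable_finsetSum _ fun i _ => i1 (hg i) (hmL (hgl i) n) hη.continuous hc
  have j3 : ∀ j, Integrable (fun x => ∑ i, g x j * mollify n (fun y => w j y i) x *
      (η x * x i)) volume := fun j => integrable_finsetSum _ fun i _ =>
    i1 (hg j) (hmL (hwl j i) n) (hb3 i) (hbc3 i)
  have J1 := integrable_finsetSum Finset.univ fun j (_ : j ∈ Finset.univ) => j1 j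
  have J12 : Integrable (fun x => (∑ j, ∑ i, g x j * mollify n (fun y => g y i) x *
      (fderiv ℝ η x (e j) * x i)) + ∑ i, g x i * mollify n (fun y => g y i) x * η x) volume :=
    J1.add j2
  rw [integral_add J12 (integrable_finsetSum Finset.univ fun j _ => j3 j), integral_add J1 j2,
    integral_finsetSum _ fun j _ => j1 j, integral_finsetSum _ fun j _ => j3 j,
    integral_finsetSum _ fun i _ => i1 (hg i) (hmL (hgl i) n) hη.continuous hc]
  congr 1
  · congr 1
    refine Finset.sum_congr rfl fun j _ => ?_
    rw [integral_finsetSum _ fun i _ => i1 (hg j) (hmL (hgl i) n) (hb1 i j) (hbc1 i j)]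
  · refine Finset.sum_congr rfl fun j _ => ?_
    rw [integral_finsetSum _ fun i _ => i1 (hg j) (hmL (hwl j i) n) (hb3 i) (hbc3 i)]

/-! ### The dilation identity for the Riesz energy. -/

/-- A smooth regularisation of the kernel `‖z‖ ^ (-lam)`. -/
noncomputable def regKernel {N : ℕ} (lam ε : ℝ) (z : Euc N) : ℝ := (‖z‖ ^ 2 + ε) ^ (-(lam / 2))

lemma regKernel_contDiff {N : ℕ} (lam : ℝ) {ε : ℝ} (hε : 0 < ε) :
    ContDiff ℝ ∞ (regKernel (N := N) lam ε) := by
  refine ContDiff.rpow_const_of_ne ((contDiff_norm_sq ℝ).add contDiff_const) fun z => ?_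
  positivity

lemma regKernel_nonneg {N : ℕ} (lam : ℝ) {ε : ℝ} (hε : 0 < ε) (z : Euc N) :
    0 ≤ regKernel lam ε z := by
  unfold regKernel; positivity

/-- Written as the kernel times a quotient, so that every term below is a dominated kernel times a
bounded multiplier. -/
lemma fderiv_regKernel {N : ℕ} (lam : ℝ) {ε : ℝ} (hε : 0 < ε) (z v : Euc N) :
    fderiv ℝ (regKernel lam ε) z v =
      - lam * (regKernel lam ε z * (inner ℝ z v / (‖z‖ ^ 2 + ε))) := by
  have hpos : 0 < ‖z‖ ^ 2 + ε := by positivity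
  have h1 : HasFDerivAt (fun z : Euc N => ‖z‖ ^ 2 + ε) (2 • innerSL ℝ z) z :=
    (hasStrictFDerivAt_norm_sq z).hasFDerivAt.add_const ε
  have h2 : HasFDerivAt (regKernel lam ε) _ z := h1.rpow_const (p := -(lam / 2)) (Or.inl hpos.ne')
  rw [h2.fderiv, regKernel, Real.rpow_sub_one hpos.ne']
  simp only [smul_apply, innerSL_apply_apply, smul_eq_mul, nsmul_eq_mul, Nat.cast_ofNat]
  field_simp

lemma regKernel_le {N : ℕ} {lam ε : ℝ} (hlam : 0 < lam) (hε : 0 < ε) {z : Euc N} (hz : z ≠ 0) :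
    regKernel lam ε z ≤ ‖z‖ ^ (-lam) := by
  have h0 : 0 < ‖z‖ := norm_pos_iff.2 hz
  have : ‖z‖ ^ (-lam) = (‖z‖ ^ 2) ^ (-(lam / 2)) := by
    rw [← Real.rpow_natCast, ← Real.rpow_mul h0.le]
    congr 1; push_cast; ring
  rw [this]
  exact Real.rpow_le_rpow_of_nonpos (by positivity) (by linarith) (by linarith)

lemma tendsto_regKernel {N : ℕ} (lam : ℝ) {z : Euc N} (hz : z ≠ 0) :
    Tendsto (fun n : ℕ => regKernel lam (1 / ((n : ℝ) + 1)) z) atTop (𝓝 (‖z‖ ^ (-lam))) := by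
  have h0 : 0 < ‖z‖ := norm_pos_iff.2 hz
  have : ‖z‖ ^ (-lam) = (‖z‖ ^ 2 + 0) ^ (-(lam / 2)) := by
    rw [add_zero, ← Real.rpow_natCast, ← Real.rpow_mul h0.le]
    congr 1; push_cast; ring
  rw [this]
  refine Tendsto.rpow_const ?_ (Or.inl (by positivity))
  exact tendsto_const_nhds.add tendsto_one_div_add_atTop_nhds_zero_nat

lemma ae_prod_fst_ne_snd {N : ℕ} (hN : 0 < N) :
    ∀ᵐ z ∂((volume : Measure (Euc N)).prod volume), z.2 - z.1 ≠ 0 := by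
  have : Nonempty (Fin N) := ⟨⟨0, hN⟩⟩
  have hm : MeasurableSet {z : Euc N × Euc N | z.2 - z.1 = 0} :=
    (isClosed_eq (by fun_prop) continuous_const).measurableSet
  have h0 : ((volume : Measure (Euc N)).prod volume) {z | z.2 - z.1 = 0} = 0 := by
    rw [Measure.measure_prod_null hm]
    refine Eventually.of_forall fun x => ?_
    have : Prod.mk x ⁻¹' {z : Euc N × Euc N | z.2 - z.1 = 0} = {x} := by
      ext y; simp [sub_eq_zero]
    change volume (Prod.mk x ⁻¹' {z : Euc N × Euc N | z.2 - z.1 = 0}) = 0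
    rw [this]
    simp
  rw [ae_iff]
  simpa using h0

lemma integrable_of_abs_le_mul {α : Type*} [MeasurableSpace α] {μ : Measure α} {W F : α → ℝ}
    (hW : Integrable W μ) (hF : AEStronglyMeasurable F μ) (C : ℝ)
    (h : ∀ᵐ z ∂μ, |F z| ≤ C * |W z|) : Integrable F μ :=
  (hW.abs.const_mul C).mono' hF h

lemma exists_bound_nsmul_add_fderiv_self {N : ℕ} {η : Euc N → ℝ} (hη : ContDiff ℝ ∞ η)
    (hc : HasCompactSupport η) : ∃ C, ∀ x, |N * η x + fderiv ℝ η x x| ≤ C := by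
  have hbN : Continuous fun x : Euc N => N * η x + fderiv ℝ η x x :=
    (continuous_const.mul hη.continuous).add ((hη.continuous_fderiv (by simp)).clm_apply
      continuous_id)
  have hbNc : HasCompactSupport fun x : Euc N => N * η x + fderiv ℝ η x x :=
    hc.mul_left.add ((hc.fderiv (𝕜 := ℝ)).mono fun x hx => by
      contrapose! hx
      simp only [Function.mem_support, ne_eq, not_not] at hx ⊢
      simp [hx])
  exact hbN.bounded_above_of_compact_support hbNc

/-- This Lipschitz bound absorbs the additional singularity that differentiating the kernel creates
on the diagonal. -/
lemma exists_lipschitz_smul_self {N : ℕ} {η : Euc N → ℝ} (hη : ContDiff ℝ ∞ η)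
    (hc : HasCompactSupport η) :
    ∃ L : ℝ, 0 ≤ L ∧ ∀ x y : Euc N, ‖η x • x - η y • y‖ ≤ L * ‖x - y‖ := by
  have h1 : ContDiff ℝ 1 fun x : Euc N => η x • x := (hη.of_le (by simp)).smul contDiff_id
  have h2 : HasCompactSupport fun x : Euc N => η x • x := hc.smul_right
  obtain ⟨C, hC⟩ := h1.lipschitzWith_of_hasCompactSupport h2 (by simp)
  exact ⟨C, C.2, fun x y => by simpa [dist_eq_norm] using hC.dist_le_mul x y⟩

/-- The bound does not depend on `ε`, and `ε = 0` is allowed so that it also covers the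
unregularised quotient. -/
lemma abs_inner_div_le {N : ℕ} {v w : Euc N} {L ε : ℝ} (hL : 0 ≤ L) (hε : 0 ≤ ε)
    (hw : ‖w‖ ≤ L * ‖v‖) : |inner ℝ v w / (‖v‖ ^ 2 + ε)| ≤ L := by
  have hpos : 0 ≤ ‖v‖ ^ 2 + ε := by positivity
  rw [abs_div, abs_of_nonneg hpos]
  refine div_le_of_le_mul₀ hpos hL ?_
  calc |inner ℝ v w| ≤ ‖v‖ * ‖w‖ := abs_real_inner_le_norm v w
    _ ≤ ‖v‖ * (L * ‖v‖) := by gcongr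
    _ ≤ L * (‖v‖ ^ 2 + ε) := by nlinarith [mul_nonneg hL hε]

/-- The regularised form of the dilation identity for the Riesz energy. -/
lemma integral_regKernel_identity {N : ℕ} (hN : 0 < N) {lam ε : ℝ} (hlam : 0 < lam) (hε : 0 < ε)
    {f : Euc N → ℝ} {h : Euc N → Euc N} (hf : HasWeakGradient f h) {η : Euc N → ℝ}
    (hη : ContDiff ℝ ∞ η) (hc : HasCompactSupport η)
    (hff : Integrable (fun z : Euc N × Euc N => f z.1 * f z.2 * ‖z.2 - z.1‖ ^ (-lam))
      (volume.prod volume))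
    (hfb : Integrable (fun z : Euc N × Euc N => f z.1 * (η z.2 * inner ℝ (h z.2) z.2) *
      ‖z.2 - z.1‖ ^ (-lam)) (volume.prod volume)) :
    ∫ z, f z.1 * (η z.2 * inner ℝ (h z.2) z.2) * regKernel lam ε (z.2 - z.1)
        ∂((volume : Measure (Euc N)).prod volume) =
      - (∫ z : Euc N × Euc N, f z.1 * f z.2 * regKernel lam ε (z.2 - z.1) *
        (N * η z.2 + fderiv ℝ η z.2 z.2) ∂((volume : Measure (Euc N)).prod volume)) +
      lam / 2 * ∫ z : Euc N × Euc N, f z.1 * f z.2 * regKernel lam ε (z.2 - z.1) *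
        (inner ℝ (z.2 - z.1) (η z.2 • z.2 - η z.1 • z.1) / (‖z.2 - z.1‖ ^ 2 + ε))
        ∂((volume : Measure (Euc N)).prod volume) := by
  set μ := (volume : Measure (Euc N)).prod (volume : Measure (Euc N)) with hμ
  set K : Euc N → ℝ := regKernel lam ε with hK
  have hKs : ContDiff ℝ ∞ K := regKernel_contDiff lam hε
  have hK0 : ∀ z, 0 ≤ K z := regKernel_nonneg lam hε
  have hfm : AEStronglyMeasurable f volume := by
    have := (hf ⟨0, hN⟩).1
    exact this.aestronglyMeasurable
  have hhm : AEStronglyMeasurable (fun x => inner ℝ (h x) x) volume := by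
    simp_rw [inner_eq_sum]
    refine Finset.aestronglyMeasurable_fun_sum _ fun i _ => ?_
    exact (show Continuous fun x : Euc N => x i by fun_prop).aestronglyMeasurable.mul
      (hf i).2.1.aestronglyMeasurable
  have hKm : AEStronglyMeasurable (fun z : Euc N × Euc N => K (z.2 - z.1)) μ :=
    (hKs.continuous.comp (by fun_prop)).aestronglyMeasurable
  have hffm : AEStronglyMeasurable (fun z : Euc N × Euc N => f z.1 * f z.2) μ :=
    hfm.comp_fst.mul hfm.comp_snd
  have hle : ∀ᵐ z ∂μ, K (z.2 - z.1) ≤ ‖z.2 - z.1‖ ^ (-lam) := by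
    filter_upwards [ae_prod_fst_ne_snd hN] with z hz
    exact regKernel_le hlam hε hz
  -- Integrability against the singular kernel passes to the regularised one with any bounded
  -- measurable multiplier, since the latter kernel is smaller off the diagonal.
  have hdom : ∀ {a : Euc N × Euc N → ℝ},
      Integrable (fun z => a z * ‖z.2 - z.1‖ ^ (-lam)) μ → AEStronglyMeasurable a μ →
      ∀ {m : Euc N × Euc N → ℝ}, AEStronglyMeasurable m μ → ∀ C : ℝ, (∀ z, |m z| ≤ C) →
      Integrable (fun z => a z * K (z.2 - z.1) * m z) μ := by
    intro a ha ham m hm C hC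
    refine integrable_of_abs_le_mul ha ((ham.mul hKm).mul hm) C ?_
    filter_upwards [hle] with z hz
    rw [abs_mul, abs_mul, abs_mul, abs_of_nonneg (hK0 _),
      abs_of_nonneg (by positivity : 0 ≤ ‖z.2 - z.1‖ ^ (-lam)), mul_comm C]
    have := hC z
    gcongr
  obtain ⟨CN, hCN⟩ := exists_bound_nsmul_add_fderiv_self hη hc
  obtain ⟨L, hL0, hL⟩ := exists_lipschitz_smul_self hη hc
  have hXc : Continuous fun x : Euc N => η x • x := hη.continuous.smul continuous_id
  obtain ⟨B, hB⟩ := hXc.bounded_above_of_compact_support hc.smul_right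
  have hB0 : 0 ≤ B := (norm_nonneg _).trans (hB 0)
  have hden : ∀ z : Euc N × Euc N, ‖z.2 - z.1‖ ^ 2 + ε ≠ 0 := fun z => by positivity
  have hI0 : Integrable (fun z : Euc N × Euc N =>
      f z.1 * (η z.2 * inner ℝ (h z.2) z.2) * K (z.2 - z.1)) μ := by
    have hm : AEStronglyMeasurable
        (fun z : Euc N × Euc N => f z.1 * (η z.2 * inner ℝ (h z.2) z.2)) μ :=
      hfm.comp_fst.mul ((hη.continuous.aestronglyMeasurable.mul hhm).comp_snd)
    simpa using hdom hfb hm (m := fun _ => 1) aestronglyMeasurable_const 1 (by simp)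
  have hI1 : Integrable (fun z : Euc N × Euc N => f z.1 * f z.2 * K (z.2 - z.1) *
      (N * η z.2 + fderiv ℝ η z.2 z.2)) μ := by
    refine hdom hff hffm ?_ CN fun z => hCN z.2
    have : Continuous fun x : Euc N => N * η x + fderiv ℝ η x x :=
      (continuous_const.mul hη.continuous).add ((hη.continuous_fderiv (by simp)).clm_apply
        continuous_id)
    exact (this.comp continuous_snd).aestronglyMeasurable
  -- A constant depending on `ε` is harmless here: it serves only to make the unsymmetrised
  -- integrals finite before they are combined.
  have htb : ∀ t : ℝ, 0 ≤ t → t ≤ (1 + 1 / ε) * (t ^ 2 + ε) := fun t ht => by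
    have : (1 + 1 / ε) * (t ^ 2 + ε) = t ^ 2 + ε + t ^ 2 / ε + 1 := by field_simp; ring
    rw [this]
    have h2 : 0 ≤ t ^ 2 / ε := by positivity
    nlinarith [sq_nonneg (t - 1)]
  have hI2 : Integrable (fun z : Euc N × Euc N => f z.1 * f z.2 * K (z.2 - z.1) *
      (inner ℝ (z.2 - z.1) (η z.2 • z.2) / (‖z.2 - z.1‖ ^ 2 + ε))) μ := by
    refine hdom hff hffm ?_ ((1 + 1 / ε) * B) fun z => ?_
    · refine (Continuous.div ?_ (by fun_prop) hden).aestronglyMeasurable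
      exact Continuous.inner (by fun_prop) (hXc.comp continuous_snd)
    · have hpos : 0 < ‖z.2 - z.1‖ ^ 2 + ε := by positivity
      rw [abs_div, abs_of_pos hpos, div_le_iff₀ hpos]
      calc |inner ℝ (z.2 - z.1) (η z.2 • z.2)| ≤ ‖z.2 - z.1‖ * ‖η z.2 • z.2‖ :=
            abs_real_inner_le_norm _ _
        _ ≤ ((1 + 1 / ε) * (‖z.2 - z.1‖ ^ 2 + ε)) * B := by
            gcongr
            · exact htb _ (norm_nonneg _)
            · exact hB _
        _ = _ := by ring
  -- For frozen `y`, the smooth function `x ↦ η x * K (x - y)` is an admissible weight in the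
  -- integration by parts for `f`.
  have hpt : ∀ y : Euc N, ∫ x, f y * (η x * inner ℝ (h x) x) * K (x - y) =
      ∫ x, (- (f y * f x * K (x - y) * (N * η x + fderiv ℝ η x x)) +
        lam * (f y * f x * K (x - y) *
          (inner ℝ (x - y) (η x • x) / (‖x - y‖ ^ 2 + ε)))) := by
    intro y
    have hsm : ContDiff ℝ ∞ fun x => η x * K (x - y) := by fun_prop
    have hd : ∀ x v, fderiv ℝ (fun x => η x * K (x - y)) x v =
        η x * (- lam * (K (x - y) * (inner ℝ (x - y) v / (‖x - y‖ ^ 2 + ε)))) +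
          K (x - y) * fderiv ℝ η x v := fun x v => by
      have h1 : HasFDerivAt η (fderiv ℝ η x) x := (hη.differentiable (by simp) x).hasFDerivAt
      have h2 : HasFDerivAt K (fderiv ℝ K (x - y)) (x - y) :=
        (hKs.differentiable (by simp) _).hasFDerivAt
      have h3' : HasFDerivAt (fun x : Euc N => x - y) (ContinuousLinearMap.id ℝ (Euc N)) x :=
        (hasFDerivAt_id x).sub_const y
      have h3 := HasFDerivAt.comp (g := K) (f := fun x : Euc N => x - y) x h2 h3'
      have h4 : HasFDerivAt (fun x => η x * K (x - y)) _ x := h1.mul h3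
      rw [h4.fderiv, ← fderiv_regKernel lam hε]
      simp [hK]
    have h5 := hf.integral_mul_inner_self hsm hc.mul_right
    have h6 : ∫ x, f y * (η x * inner ℝ (h x) x) * K (x - y) =
        f y * ∫ x, η x * K (x - y) * inner ℝ (h x) x := by
      rw [← integral_const_mul]
      congr 1; ext x; ring
    rw [h6, h5, ← integral_neg, ← integral_const_mul]
    congr 1; ext x
    rw [hd, real_inner_smul_right]
    ring
  have h1 : ∫ z : Euc N × Euc N, f z.1 * (η z.2 * inner ℝ (h z.2) z.2) * K (z.2 - z.1) ∂μ =
      - (∫ z : Euc N × Euc N, f z.1 * f z.2 * K (z.2 - z.1) *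
        (N * η z.2 + fderiv ℝ η z.2 z.2) ∂μ) +
      lam * ∫ z : Euc N × Euc N, f z.1 * f z.2 * K (z.2 - z.1) *
        (inner ℝ (z.2 - z.1) (η z.2 • z.2) / (‖z.2 - z.1‖ ^ 2 + ε)) ∂μ := by
    have hIn : Integrable (fun z : Euc N × Euc N => - (f z.1 * f z.2 * K (z.2 - z.1) *
      (N * η z.2 + fderiv ℝ η z.2 z.2))) μ := hI1.neg
    have hadd : Integrable (fun z : Euc N × Euc N => - (f z.1 * f z.2 * K (z.2 - z.1) *
      (N * η z.2 + fderiv ℝ η z.2 z.2)) + lam * (f z.1 * f z.2 * K (z.2 - z.1) *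
        (inner ℝ (z.2 - z.1) (η z.2 • z.2) / (‖z.2 - z.1‖ ^ 2 + ε)))) μ :=
      hIn.add (hI2.const_mul lam)
    rw [← integral_neg, ← integral_const_mul, ← integral_add hIn (hI2.const_mul lam),
      integral_prod _ hI0, integral_prod _ hadd]
    exact integral_congr_ae (Eventually.of_forall hpt)
  -- Exchanging the variables preserves `f z.1 * f z.2` and the even kernel, and reverses the sign
  -- of `z.2 - z.1`. Averaging the two forms gives the factor `lam / 2` and the difference of the
  -- field values.
  have h2 : ∫ z : Euc N × Euc N, f z.1 * f z.2 * K (z.2 - z.1) *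
        (inner ℝ (z.2 - z.1) (η z.2 • z.2) / (‖z.2 - z.1‖ ^ 2 + ε)) ∂μ =
      - ∫ z : Euc N × Euc N, f z.1 * f z.2 * K (z.2 - z.1) *
        (inner ℝ (z.2 - z.1) (η z.1 • z.1) / (‖z.2 - z.1‖ ^ 2 + ε)) ∂μ := by
    rw [← integral_neg, ← integral_prod_swap]
    congr 1; ext z
    have e1 : K (z.1 - z.2) = K (z.2 - z.1) := by simp only [hK, regKernel, norm_sub_rev]
    simp only [Prod.fst_swap, Prod.snd_swap]
    rw [e1, norm_sub_rev, ← neg_sub z.2 z.1, inner_neg_left]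
    ring
  have hI3 : Integrable (fun z : Euc N × Euc N => f z.1 * f z.2 * K (z.2 - z.1) *
      (inner ℝ (z.2 - z.1) (η z.1 • z.1) / (‖z.2 - z.1‖ ^ 2 + ε))) μ := by
    have := hI2.swap.neg
    refine this.congr (Eventually.of_forall fun z => ?_)
    have e1 : K (z.1 - z.2) = K (z.2 - z.1) := by simp only [hK, regKernel, norm_sub_rev]
    simp only [Pi.neg_apply, Function.comp_apply, Prod.fst_swap, Prod.snd_swap]
    rw [e1, norm_sub_rev, ← neg_sub z.2 z.1, inner_neg_left]
    ring
  have h3 : ∫ z : Euc N × Euc N, f z.1 * f z.2 * K (z.2 - z.1) *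
        (inner ℝ (z.2 - z.1) (η z.2 • z.2 - η z.1 • z.1) / (‖z.2 - z.1‖ ^ 2 + ε)) ∂μ =
      (∫ z : Euc N × Euc N, f z.1 * f z.2 * K (z.2 - z.1) *
        (inner ℝ (z.2 - z.1) (η z.2 • z.2) / (‖z.2 - z.1‖ ^ 2 + ε)) ∂μ) -
      ∫ z : Euc N × Euc N, f z.1 * f z.2 * K (z.2 - z.1) *
        (inner ℝ (z.2 - z.1) (η z.1 • z.1) / (‖z.2 - z.1‖ ^ 2 + ε)) ∂μ := by
    rw [← integral_sub hI2 hI3]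
    congr 1; ext z
    rw [inner_sub_right]
    ring
  rw [h1, h3]
  linear_combination lam / 2 * h2

/-- The dilation identity for the Riesz energy. -/
lemma integral_riesz_identity {N : ℕ} (hN : 0 < N) {lam : ℝ} (hlam : 0 < lam)
    {f : Euc N → ℝ} {h : Euc N → Euc N} (hf : HasWeakGradient f h) {η : Euc N → ℝ}
    (hη : ContDiff ℝ ∞ η) (hc : HasCompactSupport η)
    (hff : Integrable (fun z : Euc N × Euc N => f z.1 * f z.2 * ‖z.2 - z.1‖ ^ (-lam))
      (volume.prod volume))
    (hfb : Integrable (fun z : Euc N × Euc N => f z.1 * (η z.2 * inner ℝ (h z.2) z.2) *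
      ‖z.2 - z.1‖ ^ (-lam)) (volume.prod volume)) :
    ∫ z : Euc N × Euc N, f z.1 * (η z.2 * inner ℝ (h z.2) z.2) * ‖z.2 - z.1‖ ^ (-lam)
        ∂((volume : Measure (Euc N)).prod volume) =
      - (∫ z : Euc N × Euc N, f z.1 * f z.2 * ‖z.2 - z.1‖ ^ (-lam) *
        (N * η z.2 + fderiv ℝ η z.2 z.2) ∂((volume : Measure (Euc N)).prod volume)) +
      lam / 2 * ∫ z : Euc N × Euc N, f z.1 * f z.2 * ‖z.2 - z.1‖ ^ (-lam) *
        (inner ℝ (z.2 - z.1) (η z.2 • z.2 - η z.1 • z.1) / (‖z.2 - z.1‖ ^ 2))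
        ∂((volume : Measure (Euc N)).prod volume) := by
  set μ := (volume : Measure (Euc N)).prod (volume : Measure (Euc N)) with hμ
  have hεpos : ∀ n : ℕ, (0 : ℝ) < 1 / ((n : ℝ) + 1) := fun n => by positivity
  have hfm : AEStronglyMeasurable f volume := by
    have := (hf ⟨0, hN⟩).1
    exact this.aestronglyMeasurable
  have hhm : AEStronglyMeasurable (fun x => inner ℝ (h x) x) volume := by
    simp_rw [inner_eq_sum]
    refine Finset.aestronglyMeasurable_fun_sum _ fun i _ => ?_
    exact (show Continuous fun x : Euc N => x i by fun_prop).aestronglyMeasurable.mul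
      (hf i).2.1.aestronglyMeasurable
  have hffm : AEStronglyMeasurable (fun z : Euc N × Euc N => f z.1 * f z.2) μ :=
    hfm.comp_fst.mul hfm.comp_snd
  have hfbm : AEStronglyMeasurable
      (fun z : Euc N × Euc N => f z.1 * (η z.2 * inner ℝ (h z.2) z.2)) μ :=
    hfm.comp_fst.mul ((hη.continuous.aestronglyMeasurable.mul hhm).comp_snd)
  have hlim : ∀ {a : Euc N × Euc N → ℝ} {m : ℕ → Euc N × Euc N → ℝ} {m' : Euc N × Euc N → ℝ},
      Integrable (fun z => a z * ‖z.2 - z.1‖ ^ (-lam)) μ → AEStronglyMeasurable a μ →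
      (∀ n, AEStronglyMeasurable (m n) μ) → ∀ C : ℝ, (∀ n z, |m n z| ≤ C) →
      (∀ z, z.2 - z.1 ≠ 0 → Tendsto (fun n => m n z) atTop (𝓝 (m' z))) →
      Tendsto (fun n : ℕ => ∫ z, a z * regKernel lam (1 / ((n : ℝ) + 1)) (z.2 - z.1) * m n z ∂μ)
        atTop (𝓝 (∫ z, a z * ‖z.2 - z.1‖ ^ (-lam) * m' z ∂μ)) := by
    intro a m m' ha ham hm C hC hmt
    refine tendsto_integral_of_dominated_convergence
      (fun z => C * |a z * ‖z.2 - z.1‖ ^ (-lam)|) (fun n => ?_) (ha.abs.const_mul C) (fun n => ?_)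
      ?_
    · exact (ham.mul (((regKernel_contDiff lam (hεpos n)).continuous.comp
        (by fun_prop)).aestronglyMeasurable)).mul (hm n)
    · filter_upwards [ae_prod_fst_ne_snd hN] with z hz
      have h1 := regKernel_le hlam (hεpos n) hz
      have h2 := regKernel_nonneg lam (hεpos n) (z.2 - z.1)
      have := hC n z
      rw [Real.norm_eq_abs, abs_mul, abs_mul, abs_mul, abs_of_nonneg h2,
        abs_of_nonneg (by positivity : 0 ≤ ‖z.2 - z.1‖ ^ (-lam)), mul_comm C]
      gcongr
    · filter_upwards [ae_prod_fst_ne_snd hN] with z hz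
      exact ((tendsto_regKernel lam hz).const_mul (a z)).mul (hmt z hz)
  obtain ⟨CN, hCN⟩ := exists_bound_nsmul_add_fderiv_self hη hc
  obtain ⟨L, hL0, hL⟩ := exists_lipschitz_smul_self hη hc
  have hbN : Continuous fun x : Euc N => N * η x + fderiv ℝ η x x :=
    (continuous_const.mul hη.continuous).add ((hη.continuous_fderiv (by simp)).clm_apply
      continuous_id)
  have hXc : Continuous fun x : Euc N => η x • x := hη.continuous.smul continuous_id
  have t0 := hlim (m := fun _ _ => 1) (m' := fun _ => 1) hfb hfbm
    (fun _ => aestronglyMeasurable_const) 1 (by simp) (fun _ _ => tendsto_const_nhds)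
  have t1 := hlim (m := fun _ z => N * η z.2 + fderiv ℝ η z.2 z.2)
    (m' := fun z => N * η z.2 + fderiv ℝ η z.2 z.2) hff hffm
    (fun _ => (hbN.comp continuous_snd).aestronglyMeasurable) CN (fun _ z => hCN z.2)
    (fun _ _ => tendsto_const_nhds)
  -- Here symmetrisation pays off: the Lipschitz constant `L` bounds the multiplier for all `n`,
  -- which fails for either field value taken alone.
  have t2 := hlim (m := fun n z => inner ℝ (z.2 - z.1) (η z.2 • z.2 - η z.1 • z.1) /
      (‖z.2 - z.1‖ ^ 2 + 1 / ((n : ℝ) + 1)))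
    (m' := fun z => inner ℝ (z.2 - z.1) (η z.2 • z.2 - η z.1 • z.1) / (‖z.2 - z.1‖ ^ 2)) hff hffm
    (fun n => by
      refine (Continuous.div ?_ (by fun_prop) fun z => ?_).aestronglyMeasurable
      · exact Continuous.inner (by fun_prop)
          ((hXc.comp continuous_snd).sub (hXc.comp continuous_fst))
      · have := hεpos n
        positivity) L
    (fun n z => abs_inner_div_le hL0 (hεpos n).le (hL _ _))
    (fun z hz => by
      refine tendsto_const_nhds.div ?_ (by positivity)
      simpa using (tendsto_const_nhds (x := ‖z.2 - z.1‖ ^ 2)).add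
        tendsto_one_div_add_atTop_nhds_zero_nat)
  simp only [mul_one] at t0
  exact tendsto_nhds_unique t0 ((t1.neg.add (t2.const_mul (lam / 2))).congr fun n =>
    (integral_regKernel_identity hN hlam (hεpos n) hf hη hc hff hfb).symm)

/-! ### The Riesz potential in Lebesgue spaces. -/

/-- The constant in front of the Riesz kernel. -/
noncomputable def rieszConst (N : ℕ) (α : ℝ) : ℝ :=
  Real.Gamma (((N : ℝ) - α) / 2) /
    (Real.Gamma (α / 2) * Real.pi ^ ((N : ℝ) / 2) * (2 : ℝ) ^ α)

lemma rieszKernel_eq (N : ℕ) (α : ℝ) (z : Euc N) :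
    rieszKernel N α z = rieszConst N α * ‖z‖ ^ (-((N : ℝ) - α)) := by
  rw [rieszKernel, rieszConst, Real.rpow_neg (norm_nonneg _), ← div_eq_mul_inv, div_div]

lemma rieszPotential_eq {N : ℕ} (α p : ℝ) (u : Euc N → ℝ) (x : Euc N) :
    rieszPotential α p u x =
      rieszConst N α * ∫ y, |u y| ^ p * ‖x - y‖ ^ (-((N : ℝ) - α)) := by
  rw [rieszPotential, convolution_eq_swap, ← integral_const_mul]
  congr 1; ext y
  rw [rieszKernel_eq]
  simp only [ContinuousLinearMap.lsmul_apply, smul_eq_mul]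
  ring

lemma aestronglyMeasurable_riesz_integrand {N : ℕ} (lam : ℝ) {a b : Euc N → ℝ}
    (ha : AEStronglyMeasurable a volume) (hb : AEStronglyMeasurable b volume) :
    AEStronglyMeasurable (fun z : Euc N × Euc N => a z.1 * b z.2 * ‖z.2 - z.1‖ ^ (-lam))
      (volume.prod volume) := by
  have hk : Measurable fun z : Euc N × Euc N => ‖z.2 - z.1‖ ^ (-lam) := by fun_prop
  exact (ha.comp_fst.mul hb.comp_snd).mul hk.aestronglyMeasurable

/-- The Hardy–Littlewood–Sobolev inequality on the product space. -/
lemma exists_lintegral_prod_riesz_le {N : ℕ} {lam r : ℝ} (h0 : 0 < lam) (hN : lam < N)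
    (hr : r = 2 * N / (2 * N - lam)) :
    ∃ C : ℝ≥0∞, C ≠ ⊤ ∧ ∀ a b : Euc N → ℝ, MemLp a (ENNReal.ofReal r) volume →
      MemLp b (ENNReal.ofReal r) volume →
      ∫⁻ z : Euc N × Euc N, ‖a z.1 * b z.2 * ‖z.2 - z.1‖ ^ (-lam)‖ₑ ∂(volume.prod volume) ≤
        C * eLpNorm a (ENNReal.ofReal r) volume * eLpNorm b (ENNReal.ofReal r) volume := by
  obtain ⟨C, hC, hB⟩ := hardy_littlewood_sobolev h0 hN hr
  refine ⟨C, hC, fun a b ha hb => ?_⟩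
  rw [lintegral_prod _ (aestronglyMeasurable_riesz_integrand lam ha.1 hb.1).enorm]
  refine le_trans (le_of_eq ?_) (hB a b ha hb)
  refine lintegral_congr fun x => lintegral_congr fun y => ?_
  rw [enorm_mul, enorm_mul, norm_sub_rev, Real.enorm_of_nonneg (r := ‖x - y‖ ^ (-lam))
    (by positivity)]

lemma integrable_prod_riesz {N : ℕ} {lam r : ℝ} (h0 : 0 < lam) (hN : lam < N)
    (hr : r = 2 * N / (2 * N - lam)) {a b : Euc N → ℝ} (ha : MemLp a (ENNReal.ofReal r) volume)
    (hb : MemLp b (ENNReal.ofReal r) volume) :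
    Integrable (fun z : Euc N × Euc N => a z.1 * b z.2 * ‖z.2 - z.1‖ ^ (-lam))
      (volume.prod volume) := by
  obtain ⟨C, hC, hB⟩ := exists_lintegral_prod_riesz_le h0 hN hr
  refine ⟨aestronglyMeasurable_riesz_integrand lam ha.1 hb.1, (hB a b ha hb).trans_lt ?_⟩
  exact ENNReal.mul_lt_top (ENNReal.mul_lt_top hC.lt_top ha.2) hb.2

section RieszPotential

variable {N : ℕ} {α p : ℝ} {u : Euc N → ℝ}

lemma riesz_exponent (N : ℕ) (α : ℝ) :
    2 * (N : ℝ) / (N + α) = 2 * N / (2 * N - (N - α)) := by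
  congr 1; ring

lemma memLp_abs_rpow (hp : 1 < p)
    (hu : MemLp u (ENNReal.ofReal (2 * N * p / (N + α))) volume) :
    MemLp (fun x => |u x| ^ p) (ENNReal.ofReal (2 * N / (N + α))) volume := by
  have h := hu.norm_rpow_div (ENNReal.ofReal p)
  rw [ENNReal.toReal_ofReal (by linarith), ← ENNReal.ofReal_div_of_pos (by linarith)] at h
  have hp0 : p ≠ 0 := by linarith
  rw [div_right_comm, mul_div_cancel_right₀ _ hp0] at h
  exact h

lemma abs_rpow_sub_two_mul (hp : 1 < p) (t : ℝ) : |(|t| ^ (p - 2) * t)| = |t| ^ (p - 1) := by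
  have h := abs_rpow_deriv hp t
  rw [mul_assoc, abs_mul, abs_of_pos (by linarith : 0 < p)] at h
  exact mul_left_cancel₀ (by linarith) h

lemma continuous_abs_rpow_sub_two_mul (hp : 1 < p) : Continuous fun t : ℝ => |t| ^ (p - 2) * t := by
  have h := (continuous_rpow_deriv hp).const_mul p⁻¹
  convert h using 1
  ext t
  field_simp

lemma memLp_abs_rpow_sub_two_mul (hp : 1 < p) {q : ℝ}
    (hu : MemLp u (ENNReal.ofReal q) volume) :
    MemLp (fun x => |u x| ^ (p - 2) * u x) (ENNReal.ofReal (q / (p - 1))) volume := by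
  have h := hu.norm_rpow_div (ENNReal.ofReal (p - 1))
  rw [ENNReal.toReal_ofReal (by linarith), ← ENNReal.ofReal_div_of_pos (by linarith)] at h
  refine h.congr_norm ((continuous_abs_rpow_sub_two_mul hp).comp_aestronglyMeasurable hu.1)
    (Eventually.of_forall fun x => ?_)
  simp only [Real.norm_eq_abs]
  rw [abs_rpow_sub_two_mul hp, abs_of_nonneg (by positivity)]

/-- With `q = 2Np/(N+α)` this is `(p-1)/q + 1/q = p/q`, and `q/p = 2N/(N+α)` is the diagonal
Hardy–Littlewood–Sobolev exponent for the kernel power `N - α`. -/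
lemma holderTriple_riesz (hα : 0 < α) (hαN : α < N) (hp : 1 < p) :
    ENNReal.HolderTriple (ENNReal.ofReal (2 * N * p / (N + α) / (p - 1)))
      (ENNReal.ofReal (2 * N * p / (N + α))) (ENNReal.ofReal (2 * N / (N + α))) := by
  have h1 : 0 < (N : ℝ) + α := by linarith
  have h2 : 0 < (N : ℝ) := by linarith
  have h3 : 0 < p - 1 := by linarith
  have h4 : 0 < p := by linarith
  constructor
  rw [← ENNReal.ofReal_inv_of_pos (by positivity), ← ENNReal.ofReal_inv_of_pos (by positivity),
    ← ENNReal.ofReal_inv_of_pos (by positivity), ← ENNReal.ofReal_add (by positivity)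
    (by positivity)]
  congr 1
  field_simp
  ring

lemma memLp_abs_rpow_sub_two_mul_mul (hα : 0 < α) (hαN : α < N) (hp : 1 < p)
    (hu : MemLp u (ENNReal.ofReal (2 * N * p / (N + α))) volume) {v : Euc N → ℝ}
    (hv : MemLp v (ENNReal.ofReal (2 * N * p / (N + α))) volume) :
    MemLp (fun x => |u x| ^ (p - 2) * u x * v x) (ENNReal.ofReal (2 * N / (N + α))) volume := by
  have := holderTriple_riesz hα hαN hp
  exact hv.mul (memLp_abs_rpow_sub_two_mul hp hu)

lemma eLpNorm_abs_rpow_sub_two_mul_mul_le (hα : 0 < α) (hαN : α < N) (hp : 1 < p)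
    (hu : MemLp u (ENNReal.ofReal (2 * N * p / (N + α))) volume) {v : Euc N → ℝ}
    (hv : MemLp v (ENNReal.ofReal (2 * N * p / (N + α))) volume) :
    eLpNorm (fun x => |u x| ^ (p - 2) * u x * v x) (ENNReal.ofReal (2 * N / (N + α))) volume ≤
      eLpNorm (fun x => |u x| ^ (p - 2) * u x)
        (ENNReal.ofReal (2 * N * p / (N + α) / (p - 1))) volume *
      eLpNorm v (ENNReal.ofReal (2 * N * p / (N + α))) volume := by
  have := holderTriple_riesz hα hαN hp
  have h : eLpNorm ((fun x => |u x| ^ (p - 2) * u x) • v)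
      (ENNReal.ofReal (2 * N / (N + α))) volume ≤ _ :=
    eLpNorm_smul_le_mul_eLpNorm (p := ENNReal.ofReal (2 * N * p / (N + α) / (p - 1)))
      (q := ENNReal.ofReal (2 * N * p / (N + α))) hv.1 (memLp_abs_rpow_sub_two_mul hp hu).1
  exact h

/-- Fubini, justified by the Hardy–Littlewood–Sobolev bound; the second coordinate is the point at
which the potential is evaluated. -/
lemma integrable_rieszPotential_mul (hα : 0 < α) (hαN : α < N) (hp : 1 < p)
    (hu : MemLp u (ENNReal.ofReal (2 * N * p / (N + α))) volume) {b : Euc N → ℝ}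
    (hb : MemLp b (ENNReal.ofReal (2 * N / (N + α))) volume) :
    Integrable (fun x => rieszPotential α p u x * b x) volume ∧
    ∫ x, rieszPotential α p u x * b x = rieszConst N α *
      ∫ z : Euc N × Euc N, |u z.1| ^ p * b z.2 * ‖z.2 - z.1‖ ^ (-((N : ℝ) - α))
        ∂(volume.prod volume) := by
  have hI := integrable_prod_riesz (by linarith) (by linarith) (riesz_exponent N α)
    (memLp_abs_rpow hp hu) hb
  have heq : ∀ x, rieszPotential α p u x * b x = rieszConst N α *
      ∫ y, |u y| ^ p * b x * ‖x - y‖ ^ (-((N : ℝ) - α)) := fun x => by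
    rw [rieszPotential_eq, mul_assoc, ← integral_mul_const]
    congr 2; ext y; ring
  simp_rw [heq]
  refine ⟨hI.integral_prod_right.const_mul _, ?_⟩
  rw [integral_const_mul, integral_prod_symm _ hI]

/-- Pairing with indicators of balls makes the double integrand integrable, so almost every section
over each ball is integrable. Countably many balls cover the space. -/
lemma ae_convolutionExistsAt_riesz (hα : 0 < α) (hαN : α < N) (hp : 1 < p)
    (hu : MemLp u (ENNReal.ofReal (2 * N * p / (N + α))) volume) :
    ∀ᵐ x, ConvolutionExistsAt (rieszKernel N α) (fun y => |u y| ^ p) x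
      (ContinuousLinearMap.lsmul ℝ ℝ) volume := by
  have h1 : ∀ n : ℕ, ∀ᵐ x : Euc N, x ∈ ball (0 : Euc N) n →
      Integrable (fun y => |u y| ^ p * ‖x - y‖ ^ (-((N : ℝ) - α))) volume := by
    intro n
    have hb : MemLp ((ball (0 : Euc N) n).indicator fun _ => (1 : ℝ))
        (ENNReal.ofReal (2 * N / (N + α))) volume :=
      memLp_indicator_const _ measurableSet_ball _ (Or.inr measure_ball_lt_top.ne)
    have hI := integrable_prod_riesz (by linarith) (by linarith) (riesz_exponent N α)
      (memLp_abs_rpow hp hu) hb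
    filter_upwards [hI.prod_left_ae] with x hx hxn
    simpa [indicator_of_mem hxn] using hx
  filter_upwards [ae_all_iff.2 h1] with x hx
  obtain ⟨n, hn⟩ := exists_nat_gt ‖x‖
  have h2 := (hx n (by simpa using hn)).const_mul (rieszConst N α)
  rw [convolutionExistsAt_iff_integrable_swap]
  refine h2.congr (Eventually.of_forall fun y => ?_)
  simp only [rieszKernel_eq, ContinuousLinearMap.lsmul_apply, smul_eq_mul]
  ring

/-- By Hardy–Littlewood–Sobolev and Hölder, the pairing is a bounded linear functional of the last
factor in `L^q`; `D` is the resulting bound. -/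
lemma tendsto_integral_rieszPotential_mul (hα : 0 < α) (hαN : α < N) (hp : 1 < p)
    (hu : MemLp u (ENNReal.ofReal (2 * N * p / (N + α))) volume) {v : Euc N → ℝ}
    {V : ℕ → Euc N → ℝ} (hv : MemLp v (ENNReal.ofReal (2 * N * p / (N + α))) volume)
    (hV : ∀ n, MemLp (V n) (ENNReal.ofReal (2 * N * p / (N + α))) volume)
    (hlim : Tendsto (fun n => eLpNorm (fun x => V n x - v x)
      (ENNReal.ofReal (2 * N * p / (N + α))) volume) atTop (𝓝 0)) :
    Tendsto (fun n => ∫ x, rieszPotential α p u x * (|u x| ^ (p - 2) * u x * V n x)) atTop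
      (𝓝 (∫ x, rieszPotential α p u x * (|u x| ^ (p - 2) * u x * v x))) := by
  obtain ⟨C, hC, hB⟩ := exists_lintegral_prod_riesz_le (N := N) (by linarith) (by linarith)
    (riesz_exponent N α)
  set D := ‖rieszConst N α‖ₑ * (C * eLpNorm (fun x => |u x| ^ p)
    (ENNReal.ofReal (2 * N / (N + α))) volume * eLpNorm (fun x => |u x| ^ (p - 2) * u x)
        (ENNReal.ofReal (2 * N * p / (N + α) / (p - 1))) volume) with hD
  have hDt : D ≠ ⊤ := by
    have h1 := (memLp_abs_rpow hp hu).2.ne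
    have h2 := (memLp_abs_rpow_sub_two_mul hp hu).2.ne
    rw [hD]
    finiteness
  rw [← tendsto_sub_nhds_zero_iff, tendsto_zero_iff_enorm_tendsto_zero]
  have h3 := ENNReal.Tendsto.const_mul hlim (Or.inr hDt)
  rw [mul_zero] at h3
  refine tendsto_of_tendsto_of_tendsto_of_le_of_le tendsto_const_nhds h3 (fun _ => zero_le)
    fun n => ?_
  simp only
  have hVn := memLp_abs_rpow_sub_two_mul_mul hα hαN hp hu (hV n)
  have hvn := memLp_abs_rpow_sub_two_mul_mul hα hαN hp hu hv
  have hdn := memLp_abs_rpow_sub_two_mul_mul hα hαN hp hu ((hV n).sub hv)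
  rw [← integral_sub (integrable_rieszPotential_mul hα hαN hp hu hVn).1
    (integrable_rieszPotential_mul hα hαN hp hu hvn).1]
  have e1 : ∫ x, (rieszPotential α p u x * (|u x| ^ (p - 2) * u x * V n x) -
      rieszPotential α p u x * (|u x| ^ (p - 2) * u x * v x)) =
      ∫ x, rieszPotential α p u x * (|u x| ^ (p - 2) * u x * (V n - v) x) := by
    congr 1; ext x; simp only [Pi.sub_apply]; ring
  rw [e1, (integrable_rieszPotential_mul hα hαN hp hu hdn).2, enorm_mul]
  calc _ ≤ ‖rieszConst N α‖ₑ * (C * eLpNorm (fun x => |u x| ^ p)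
          (ENNReal.ofReal (2 * N / (N + α))) volume * (eLpNorm (fun x => |u x| ^ (p - 2) * u x)
          (ENNReal.ofReal (2 * N * p / (N + α) / (p - 1))) volume *
          eLpNorm (V n - v) (ENNReal.ofReal (2 * N * p / (N + α))) volume)) := by
        gcongr
        refine (enorm_integral_le_lintegral_enorm _).trans ((hB _ _
          (memLp_abs_rpow hp hu) hdn).trans ?_)
        gcongr
        exact eLpNorm_abs_rpow_sub_two_mul_mul_le hα hαN hp hu ((hV n).sub hv)
    _ = D * eLpNorm (V n - v) (ENNReal.ofReal (2 * N * p / (N + α))) volume := by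
        rw [hD]; ring

end RieszPotential

/-! ### The localised Pohozaev identity. -/

lemma memLp_mul_of_bounded {N : ℕ} {q : ℝ≥0∞} {b v : Euc N → ℝ} (hb : Continuous b)
    (hc : HasCompactSupport b) (hv : MemLp v q volume) : MemLp (fun x => b x * v x) q volume := by
  obtain ⟨B, hB⟩ := hb.bounded_above_of_compact_support hc
  refine hv.of_le_mul (c := B) (hb.aestronglyMeasurable.mul hv.1) (Eventually.of_forall fun x => ?_)
  rw [norm_mul]
  gcongr
  exact hB x

lemma dilation_eq_sum {N : ℕ} (η : Euc N → ℝ) (g : Euc N → Euc N) :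
    (fun x => η x * inner ℝ (g x) x) = fun x => ∑ i, (η x * x i) * g x i := by
  ext x
  rw [inner_eq_sum, Finset.mul_sum]
  exact Finset.sum_congr rfl fun i _ => by ring

lemma memLp_dilation {N : ℕ} {q : ℝ≥0∞} {η : Euc N → ℝ} {g : Euc N → Euc N} (hη : Continuous η)
    (hc : HasCompactSupport η) (hg : ∀ i, MemLp (fun x => g x i) q volume) :
    MemLp (fun x => η x * inner ℝ (g x) x) q volume := by
  rw [dilation_eq_sum]
  exact memLp_finsetSum _ fun i _ =>
    memLp_mul_of_bounded (hη.mul (by fun_prop)) hc.mul_right (hg i)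

lemma tendsto_eLpNorm_dilationTest_sub {N : ℕ} {q : ℝ≥0∞} (hq1 : 1 ≤ q) (hq : q ≠ ⊤)
    {η : Euc N → ℝ} {g : Euc N → Euc N} (hη : Continuous η) (hc : HasCompactSupport η)
    (hg : ∀ i, MemLp (fun x => g x i) q volume) :
    Tendsto (fun n => eLpNorm (fun x => dilationTest η g n x - η x * inner ℝ (g x) x) q volume)
      atTop (𝓝 0) := by
  have hb : ∀ i : Fin N, Continuous fun x : Euc N => η x * x i := fun i => hη.mul (by fun_prop)
  have hbc : ∀ i : Fin N, HasCompactSupport fun x : Euc N => η x * x i := fun i => hc.mul_right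
  choose B hB using fun i => (hb i).bounded_above_of_compact_support (hbc i)
  have h1 := tendsto_finsetSum Finset.univ fun i (_ : i ∈ Finset.univ) =>
    ENNReal.Tendsto.const_mul (tendsto_eLpNorm_mollify_sub hq1 hq (hg i))
      (Or.inr (ENNReal.ofReal_ne_top (r := B i)))
  simp only [mul_zero, Finset.sum_const_zero] at h1
  refine tendsto_of_tendsto_of_tendsto_of_le_of_le tendsto_const_nhds h1 (fun _ => zero_le)
    fun n => ?_
  have e1 : (fun x => dilationTest η g n x - η x * inner ℝ (g x) x) =
      ∑ i, fun x => (η x * x i) * (mollify n (fun y => g y i) x - g x i) := by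
    ext x
    rw [congrFun (dilation_eq_sum η g) x, dilationTest, Finset.mul_sum, ← Finset.sum_sub_distrib,
      Finset.sum_apply]
    exact Finset.sum_congr rfl fun i _ => by ring
  simp only
  rw [e1]
  refine (eLpNorm_sum_le (fun i _ => ?_) hq1).trans (Finset.sum_le_sum fun i _ => ?_)
  · exact (hb i).aestronglyMeasurable.mul ((mollify_contDiff n
      ((hg i).locallyIntegrable hq1)).continuous.aestronglyMeasurable.sub (hg i).1)
  · refine eLpNorm_le_mul_eLpNorm_of_ae_le_mul (Eventually.of_forall fun x => ?_) q
    rw [norm_mul]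
    gcongr
    exact hB i x

lemma MeasureTheory.MemLp.memLpLoc {N : ℕ} {q : ℝ≥0∞} {v : Euc N → ℝ} (h : MemLp v q volume) :
    MemLpLoc q v := fun _ _ => h.restrict _

lemma MemLpLoc.mono_exponent {N : ℕ} {q s : ℝ≥0∞} {v : Euc N → ℝ} (h : MemLpLoc q v)
    (hs : s ≤ q) : MemLpLoc s v := fun K hK => by
  have : IsFiniteMeasure ((volume : Measure (Euc N)).restrict K) :=
    isFiniteMeasure_restrict.2 hK.measure_ne_top
  exact (h K hK).mono_exponent hs

/-- The Pohozaev identity localised by a cut-off function. -/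
lemma localized_pohozaev {N : ℕ} {α p : ℝ} (hα : 0 < α) (hαN : α < N) (hp : 1 < p)
    {u : Euc N → ℝ} {g : Euc N → Euc N} {w : Fin N → Euc N → Euc N} (h : HasWeakGradient u g)
    (hu2 : MemLp u 2 volume) (hg2 : ∀ i, MemLp (fun x => g x i) 2 volume)
    (hu : MemLp u (ENNReal.ofReal (2 * N * p / (N + α))) volume)
    (hg : ∀ i, MemLp (fun x => g x i) (ENNReal.ofReal (2 * N * p / (N + α))) volume)
    (hw : ∀ j, HasWeakGradient (fun x => g x j) (w j)) (hwL : ∀ j i, MemLpLoc 2 fun x => w j x i)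
    (hsol : ∀ φ : Euc N → ℝ, ContDiff ℝ ∞ φ → HasCompactSupport φ →
      (∫ x, inner ℝ (g x) (gradient φ x)) + ∫ x, u x * φ x =
        ∫ x, rieszPotential α p u x * |u x| ^ (p - 2) * u x * φ x)
    {η : Euc N → ℝ} (hη : ContDiff ℝ ∞ η) (hc : HasCompactSupport η) :
    p * ((∫ x, fderiv ℝ η x (g x) * inner ℝ (g x) x) + (∫ x, η x * ‖g x‖ ^ 2) -
        (1 / 2) * (∫ x, ‖g x‖ ^ 2 * (N * η x + fderiv ℝ η x x)) -
        (1 / 2) * ∫ x, u x ^ 2 * (N * η x + fderiv ℝ η x x)) =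
      rieszConst N α * (- (∫ z : Euc N × Euc N, |u z.1| ^ p * |u z.2| ^ p *
        ‖z.2 - z.1‖ ^ (-((N : ℝ) - α)) * (N * η z.2 + fderiv ℝ η z.2 z.2)
          ∂((volume : Measure (Euc N)).prod volume)) +
      ((N : ℝ) - α) / 2 * ∫ z : Euc N × Euc N, |u z.1| ^ p * |u z.2| ^ p *
        ‖z.2 - z.1‖ ^ (-((N : ℝ) - α)) *
        (inner ℝ (z.2 - z.1) (η z.2 • z.2 - η z.1 • z.1) / (‖z.2 - z.1‖ ^ 2))
        ∂((volume : Measure (Euc N)).prod volume)) := by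
  have hNpos : 0 < N := by
    have : (0 : ℝ) < N := by linarith
    exact_mod_cast this
  have hNα : 0 < (N : ℝ) + α := by linarith
  -- Since `α < N`, local `L^q` is contained in local `L^p`, which is what the chain rule for
  -- `|u|^p` requires.
  have hqp : p ≤ 2 * N * p / (N + α) := by
    rw [le_div_iff₀ hNα]; nlinarith
  have hq1 : 1 ≤ ENNReal.ofReal (2 * N * p / (N + α)) := by
    rw [ENNReal.one_le_ofReal]; linarith
  have hgl : ∀ i, LocallyIntegrable (fun x => g x i) volume := fun i => (h i).2.1
  -- limit of the tested equation
  have t1 := tendsto_integral_inner_gradient_dilationTest h (fun i => (hg2 i).memLpLoc) hw hwL hη hc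
  have t2 := tendsto_integral_mul_dilationTest h hu2.memLpLoc (fun i => (hg2 i).memLpLoc) hη hc
  have hψ := memLp_dilation hη.continuous hc hg
  have hφ : ∀ n, MemLp (dilationTest η g n) (ENNReal.ofReal (2 * N * p / (N + α))) volume :=
    fun n => (dilationTest_contDiff n hη hgl).continuous.memLp_of_hasCompactSupport
      (dilationTest_hasCompactSupport n hc)
  have t3 := tendsto_integral_rieszPotential_mul hα hαN hp hu hψ hφ
    (tendsto_eLpNorm_dilationTest_sub hq1 ENNReal.ofReal_ne_top hη.continuous hc hg)
  have key := tendsto_nhds_unique (t1.add t2) (t3.congr fun n => by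
    rw [hsol _ (dilationTest_contDiff n hη hgl) (dilationTest_hasCompactSupport n hc)]
    congr 1; ext x; ring)
  -- the nonlocal term
  have hbL := memLp_abs_rpow_sub_two_mul_mul hα hαN hp hu hψ
  have hf : HasWeakGradient (fun x => |u x| ^ p) (fun x => (p * |u x| ^ (p - 2) * u x) • g x) :=
    fun i => by
      simpa using (h i).abs_rpow hp (hu.memLpLoc.mono_exponent (ENNReal.ofReal_le_ofReal hqp))
        ((hg i).memLpLoc.mono_exponent (ENNReal.ofReal_le_ofReal hqp))
  have hff := integrable_prod_riesz (by linarith) (by linarith) (riesz_exponent N α)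
    (memLp_abs_rpow hp hu) (memLp_abs_rpow hp hu)
  have hfb := integrable_prod_riesz (by linarith) (by linarith) (riesz_exponent N α)
    (memLp_abs_rpow hp hu) hbL
  -- The gradient of `|u|^p` supplies a factor `p` absent from the equation; this is why the tested
  -- equation is multiplied by `p`.
  have hpt : ∀ z : Euc N × Euc N, |u z.1| ^ p * (η z.2 *
      inner ℝ ((p * |u z.2| ^ (p - 2) * u z.2) • g z.2) z.2) * ‖z.2 - z.1‖ ^ (-((N : ℝ) - α)) =
      p * (|u z.1| ^ p * (|u z.2| ^ (p - 2) * u z.2 * (η z.2 * inner ℝ (g z.2) z.2)) *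
        ‖z.2 - z.1‖ ^ (-((N : ℝ) - α))) := fun z => by
    rw [real_inner_smul_left]; ring
  have hid := integral_riesz_identity hNpos (by linarith : 0 < (N : ℝ) - α) hf hη hc hff
    ((hfb.const_mul p).congr (Eventually.of_forall fun z => (hpt z).symm))
  simp_rw [hpt] at hid
  rw [integral_const_mul] at hid
  rw [(integrable_rieszPotential_mul hα hαN hp hu hbL).2] at key
  rw [← hid]
  linear_combination p * key

/-! ### Removing the cut-off. -/

section Cutoff

/-- A cut-off function equal to one near the origin, dilated by the factor `n + 1`. -/
noncomputable def cutoff (N n : ℕ) (x : Euc N) : ℝ :=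
  (⟨1, 2, one_pos, one_lt_two⟩ : ContDiffBump (0 : Euc N)) ((1 / ((n : ℝ) + 1)) • x)

lemma cutoff_contDiff (N n : ℕ) : ContDiff ℝ ∞ (cutoff N n) :=
  (ContDiffBump.contDiff _).comp (contDiff_const_smul _)

lemma cutoff_hasCompactSupport (N n : ℕ) : HasCompactSupport (cutoff N n) :=
  (ContDiffBump.hasCompactSupport _).comp_smul (by positivity)

lemma cutoff_zero_apply (N n : ℕ) (x : Euc N) :
    cutoff N n x = cutoff N 0 ((1 / ((n : ℝ) + 1)) • x) := by
  simp [cutoff]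

lemma cutoff_zero_zero (N : ℕ) : cutoff N 0 0 = 1 := by
  unfold cutoff
  apply ContDiffBump.one_of_mem_closedBall
  simp

lemma fderiv_cutoff (N n : ℕ) (x v : Euc N) : fderiv ℝ (cutoff N n) x v =
    (1 / ((n : ℝ) + 1)) * fderiv ℝ (cutoff N 0) ((1 / ((n : ℝ) + 1)) • x) v := by
  have h1 : HasFDerivAt (cutoff N 0) (fderiv ℝ (cutoff N 0) ((1 / ((n : ℝ) + 1)) • x))
      ((1 / ((n : ℝ) + 1)) • x) := ((cutoff_contDiff N 0).differentiable (by simp) _).hasFDerivAt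
  have h2 : HasFDerivAt (fun x : Euc N => (1 / ((n : ℝ) + 1)) • x)
      ((1 / ((n : ℝ) + 1)) • ContinuousLinearMap.id ℝ (Euc N)) x :=
    ((1 / ((n : ℝ) + 1)) • ContinuousLinearMap.id ℝ (Euc N)).hasFDerivAt
  have h3 := HasFDerivAt.comp (g := cutoff N 0)
    (f := fun x : Euc N => (1 / ((n : ℝ) + 1)) • x) x h1 h2
  have h4 : cutoff N n = cutoff N 0 ∘ fun x : Euc N => (1 / ((n : ℝ) + 1)) • x :=
    funext fun x => cutoff_zero_apply N n x
  rw [h4, h3.fderiv]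
  simp

lemma tendsto_scaled_zero {N : ℕ} (x : Euc N) :
    Tendsto (fun n : ℕ => (1 / ((n : ℝ) + 1)) • x) atTop (𝓝 0) := by
  have h : Tendsto (fun n : ℕ => 1 / ((n : ℝ) + 1)) atTop (𝓝 0) :=
    tendsto_one_div_add_atTop_nhds_zero_nat
  simpa using h.smul_const x

lemma tendsto_cutoff {N : ℕ} (x : Euc N) : Tendsto (fun n => cutoff N n x) atTop (𝓝 1) := by
  have h := ((cutoff_contDiff N 0).continuous.tendsto 0).comp (tendsto_scaled_zero x)
  rw [cutoff_zero_zero] at h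
  exact h.congr fun n => (cutoff_zero_apply N n x).symm

lemma abs_cutoff_le (N n : ℕ) (x : Euc N) : |cutoff N n x| ≤ 1 := by
  unfold cutoff
  rw [abs_of_nonneg (ContDiffBump.nonneg _)]
  exact ContDiffBump.le_one _

/-- The divergence of `η x` is invariant under dilating `η`, so one bound serves all `n` and the
limit is the value at the origin. -/
lemma divergence_cutoff (N n : ℕ) (x : Euc N) :
    N * cutoff N n x + fderiv ℝ (cutoff N n) x x =
      N * cutoff N 0 ((1 / ((n : ℝ) + 1)) • x) + fderiv ℝ (cutoff N 0)
        ((1 / ((n : ℝ) + 1)) • x) ((1 / ((n : ℝ) + 1)) • x) := by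
  rw [fderiv_cutoff, ← cutoff_zero_apply, map_smul, smul_eq_mul]

lemma continuous_divergence {N : ℕ} {η : Euc N → ℝ} (hη : ContDiff ℝ ∞ η) :
    Continuous fun x : Euc N => N * η x + fderiv ℝ η x x :=
  (continuous_const.mul hη.continuous).add ((hη.continuous_fderiv (by simp)).clm_apply
    continuous_id)

lemma exists_abs_divergence_cutoff_le (N : ℕ) :
    ∃ C, ∀ n x, |N * cutoff N n x + fderiv ℝ (cutoff N n) x x| ≤ C := by
  obtain ⟨C, hC⟩ := exists_bound_nsmul_add_fderiv_self (cutoff_contDiff N 0)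
    (cutoff_hasCompactSupport N 0)
  exact ⟨C, fun n x => by rw [divergence_cutoff]; exact hC _⟩

lemma tendsto_divergence_cutoff {N : ℕ} (x : Euc N) :
    Tendsto (fun n => N * cutoff N n x + fderiv ℝ (cutoff N n) x x) atTop (𝓝 N) := by
  have h := ((continuous_divergence (cutoff_contDiff N 0)).tendsto 0).comp (tendsto_scaled_zero x)
  rw [cutoff_zero_zero, map_zero, mul_one, add_zero] at h
  exact h.congr fun n => (divergence_cutoff N n x).symm

/-- The field for index `n` is the field for index `0` conjugated by a dilation, which preserves its
Lipschitz constant. -/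
lemma exists_lipschitz_cutoff (N : ℕ) : ∃ L : ℝ, 0 ≤ L ∧ ∀ n, ∀ x y : Euc N,
    ‖cutoff N n x • x - cutoff N n y • y‖ ≤ L * ‖x - y‖ := by
  obtain ⟨L, hL0, hL⟩ := exists_lipschitz_smul_self (cutoff_contDiff N 0)
    (cutoff_hasCompactSupport N 0)
  refine ⟨L, hL0, fun n x y => ?_⟩
  have hpos : (0 : ℝ) < 1 / ((n : ℝ) + 1) := by positivity
  have h1 := hL ((1 / ((n : ℝ) + 1)) • x) ((1 / ((n : ℝ) + 1)) • y)
  rw [← cutoff_zero_apply, ← cutoff_zero_apply, smul_comm, smul_comm (cutoff N n y), ← smul_sub,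
    ← smul_sub, norm_smul, norm_smul, Real.norm_of_nonneg hpos.le] at h1
  have h2 : 1 / ((n : ℝ) + 1) * ‖cutoff N n x • x - cutoff N n y • y‖ ≤
      1 / ((n : ℝ) + 1) * (L * ‖x - y‖) := by linarith
  exact le_of_mul_le_mul_left h2 hpos

/-- The factor `1/(n+1)` from differentiating the cut-off is absorbed by rescaling `x`, leaving the
bounded function `‖y‖ ‖∇η(y)‖` of the undilated bump. -/
lemma exists_abs_fderiv_cutoff_mul_inner_le (N : ℕ) : ∃ C, ∀ n, ∀ x v : Euc N,
    |fderiv ℝ (cutoff N n) x v * inner ℝ v x| ≤ C * ‖v‖ ^ 2 := by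
  have h1 : Continuous fun x : Euc N => ‖x‖ * ‖fderiv ℝ (cutoff N 0) x‖ :=
    continuous_norm.mul ((cutoff_contDiff N 0).continuous_fderiv (by simp)).norm
  have h1c : HasCompactSupport fun x : Euc N => ‖x‖ * ‖fderiv ℝ (cutoff N 0) x‖ :=
    ((cutoff_hasCompactSupport N 0).fderiv (𝕜 := ℝ)).norm.mul_left
  obtain ⟨C, hC⟩ := h1.bounded_above_of_compact_support h1c
  refine ⟨C, fun n x v => ?_⟩
  set y := (1 / ((n : ℝ) + 1)) • x with hy
  have h2 : fderiv ℝ (cutoff N n) x v * inner ℝ v x =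
      fderiv ℝ (cutoff N 0) y v * inner ℝ v y := by
    rw [fderiv_cutoff N n, hy, real_inner_smul_right]; ring
  have h3 := hC y
  rw [Real.norm_of_nonneg (by positivity)] at h3
  rw [h2, abs_mul]
  calc |fderiv ℝ (cutoff N 0) y v| * |inner ℝ v y|
      ≤ (‖fderiv ℝ (cutoff N 0) y‖ * ‖v‖) * (‖v‖ * ‖y‖) := by
        gcongr
        · exact (fderiv ℝ (cutoff N 0) y).le_opNorm v
        · exact abs_real_inner_le_norm v y
    _ = (‖y‖ * ‖fderiv ℝ (cutoff N 0) y‖) * ‖v‖ ^ 2 := by ring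
    _ ≤ C * ‖v‖ ^ 2 := by gcongr

lemma tendsto_fderiv_cutoff_mul_inner {N : ℕ} (x v : Euc N) :
    Tendsto (fun n => fderiv ℝ (cutoff N n) x v * inner ℝ v x) atTop (𝓝 0) := by
  have h1 : Continuous fun y : Euc N => fderiv ℝ (cutoff N 0) y v * inner ℝ v y :=
    (((cutoff_contDiff N 0).continuous_fderiv (by simp)).clm_apply continuous_const).mul
      (by fun_prop)
  have h2 := (h1.tendsto 0).comp (tendsto_scaled_zero x)
  simp only [inner_zero_right, mul_zero] at h2
  refine h2.congr fun n => ?_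
  simp only [Function.comp_apply]
  rw [fderiv_cutoff N n, real_inner_smul_right]; ring

end Cutoff

lemma tendsto_integral_mul_of_bounded {β : Type*} [MeasurableSpace β] {μ : Measure β} {a : β → ℝ}
    {m : ℕ → β → ℝ} {c C : ℝ} (ha : Integrable a μ) (hm : ∀ n, AEStronglyMeasurable (m n) μ)
    (hC : ∀ n x, |m n x| ≤ C) (hlim : ∀ᵐ x ∂μ, Tendsto (fun n => m n x) atTop (𝓝 c)) :
    Tendsto (fun n => ∫ x, a x * m n x ∂μ) atTop (𝓝 ((∫ x, a x ∂μ) * c)) := by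
  rw [← integral_mul_const]
  refine tendsto_integral_of_dominated_convergence (fun x => |a x| * C)
    (fun n => ha.1.mul (hm n)) (ha.abs.mul_const C) (fun n => Eventually.of_forall fun x => ?_) ?_
  · rw [norm_mul, Real.norm_eq_abs, Real.norm_eq_abs]
    gcongr
    exact hC n x
  · filter_upwards [hlim] with x hx using hx.const_mul _

/-- The Pohozaev identity, multiplied by `p`. -/
lemma pohozaev_of_localized {N : ℕ} {α p : ℝ} (hN : 0 < N) {u : Euc N → ℝ} {g : Euc N → Euc N}
    (hgm : AEStronglyMeasurable g volume) (hu : Integrable (fun x => u x ^ 2) volume)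
    (hg : Integrable (fun x => ‖g x‖ ^ 2) volume)
    (hW : Integrable (fun z : Euc N × Euc N => |u z.1| ^ p * |u z.2| ^ p *
        ‖z.2 - z.1‖ ^ (-((N : ℝ) - α))) (volume.prod volume))
    (hloc : ∀ η : Euc N → ℝ, ContDiff ℝ ∞ η → HasCompactSupport η →
      p * ((∫ x, fderiv ℝ η x (g x) * inner ℝ (g x) x) + (∫ x, η x * ‖g x‖ ^ 2) -
        (1 / 2) * (∫ x, ‖g x‖ ^ 2 * (N * η x + fderiv ℝ η x x)) -
        (1 / 2) * ∫ x, u x ^ 2 * (N * η x + fderiv ℝ η x x)) =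
      rieszConst N α * (- (∫ z : Euc N × Euc N, |u z.1| ^ p * |u z.2| ^ p *
        ‖z.2 - z.1‖ ^ (-((N : ℝ) - α)) * (N * η z.2 + fderiv ℝ η z.2 z.2)
          ∂((volume : Measure (Euc N)).prod volume)) +
      ((N : ℝ) - α) / 2 * ∫ z : Euc N × Euc N, |u z.1| ^ p * |u z.2| ^ p *
        ‖z.2 - z.1‖ ^ (-((N : ℝ) - α)) *
        (inner ℝ (z.2 - z.1) (η z.2 • z.2 - η z.1 • z.1) / (‖z.2 - z.1‖ ^ 2))
        ∂((volume : Measure (Euc N)).prod volume))) :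
    p * (((N : ℝ) - 2) / 2 * (∫ x, ‖g x‖ ^ 2) + (N : ℝ) / 2 * ∫ x, u x ^ 2) =
      ((N : ℝ) + α) / 2 * (rieszConst N α * ∫ z : Euc N × Euc N, |u z.1| ^ p * |u z.2| ^ p *
        ‖z.2 - z.1‖ ^ (-((N : ℝ) - α)) ∂((volume : Measure (Euc N)).prod volume)) := by
  obtain ⟨C, hC⟩ := exists_abs_divergence_cutoff_le N
  obtain ⟨L, hL0, hL⟩ := exists_lipschitz_cutoff N
  obtain ⟨B, hB⟩ := exists_abs_fderiv_cutoff_mul_inner_le N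
  have hdc : ∀ n, Continuous fun x : Euc N => N * cutoff N n x + fderiv ℝ (cutoff N n) x x :=
    fun n => continuous_divergence (cutoff_contDiff N n)
  have hXc : ∀ n, Continuous fun x : Euc N => cutoff N n x • x := fun n =>
    (cutoff_contDiff N n).continuous.smul continuous_id
  have t1 : Tendsto (fun n => ∫ x, fderiv ℝ (cutoff N n) x (g x) * inner ℝ (g x) x) atTop
      (𝓝 0) := by
    rw [← integral_zero (Euc N) ℝ]
    refine tendsto_integral_of_dominated_convergence (fun x => B * ‖g x‖ ^ 2) (fun n => ?_)
      (hg.const_mul B) (fun n => Eventually.of_forall fun x => hB n x _)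
      (Eventually.of_forall fun x => tendsto_fderiv_cutoff_mul_inner x (g x))
    refine AEStronglyMeasurable.mul ?_ (hgm.inner aestronglyMeasurable_id)
    have h1 : Continuous fun z : (Euc N →L[ℝ] ℝ) × Euc N => z.1 z.2 := by fun_prop
    exact h1.comp_aestronglyMeasurable
      (((cutoff_contDiff N n).continuous_fderiv (by simp)).aestronglyMeasurable.prodMk hgm)
  have t2 := tendsto_integral_mul_of_bounded hg
    (fun n => (cutoff_contDiff N n).continuous.aestronglyMeasurable) (abs_cutoff_le N)
    (Eventually.of_forall tendsto_cutoff)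
  have t3 := tendsto_integral_mul_of_bounded hg (fun n => (hdc n).aestronglyMeasurable) hC
    (Eventually.of_forall tendsto_divergence_cutoff)
  have t4 := tendsto_integral_mul_of_bounded hu (fun n => (hdc n).aestronglyMeasurable) hC
    (Eventually.of_forall tendsto_divergence_cutoff)
  have hm5 : ∀ n, AEStronglyMeasurable (fun z : Euc N × Euc N =>
      N * cutoff N n z.2 + fderiv ℝ (cutoff N n) z.2 z.2)
      ((volume : Measure (Euc N)).prod volume) := fun n =>
    ((hdc n).comp continuous_snd).aestronglyMeasurable
  have hl5 : ∀ᵐ z : Euc N × Euc N ∂((volume : Measure (Euc N)).prod volume),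
      Tendsto (fun n => N * cutoff N n z.2 + fderiv ℝ (cutoff N n) z.2 z.2) atTop (𝓝 (N : ℝ)) :=
    Eventually.of_forall fun z => tendsto_divergence_cutoff z.2
  have t5 := tendsto_integral_mul_of_bounded hW hm5 (fun n z => hC n z.2) hl5
  -- Off the diagonal the cut-offs tend to one and the quotient tends to `‖z.2 - z.1‖² / ‖z.2 -
  -- z.1‖² = 1`.
  have t6 := tendsto_integral_mul_of_bounded hW (c := 1) (C := L)
    (m := fun n z => inner ℝ (z.2 - z.1) (cutoff N n z.2 • z.2 - cutoff N n z.1 • z.1) /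
      (‖z.2 - z.1‖ ^ 2))
    (fun n => by
      refine AEStronglyMeasurable.div₀ ?_ ?_
      · exact (Continuous.inner (by fun_prop) (((hXc n).comp continuous_snd).sub
          ((hXc n).comp continuous_fst))).aestronglyMeasurable
      · exact (show Continuous fun z : Euc N × Euc N => ‖z.2 - z.1‖ ^ 2 by
          fun_prop).aestronglyMeasurable)
    (fun n z => by simpa using abs_inner_div_le hL0 le_rfl (hL n z.2 z.1))
    (by
      filter_upwards [ae_prod_fst_ne_snd hN] with z hz
      have h1 : ‖z.2 - z.1‖ ^ 2 ≠ 0 := by positivity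
      have h2 : Tendsto (fun n => inner ℝ (z.2 - z.1)
          (cutoff N n z.2 • z.2 - cutoff N n z.1 • z.1) / (‖z.2 - z.1‖ ^ 2)) atTop
          (𝓝 (inner ℝ (z.2 - z.1) ((1 : ℝ) • z.2 - (1 : ℝ) • z.1) / (‖z.2 - z.1‖ ^ 2))) :=
        (tendsto_const_nhds.inner (((tendsto_cutoff z.2).smul_const z.2).sub
          ((tendsto_cutoff z.1).smul_const z.1))).div_const _
      rwa [one_smul, one_smul, real_inner_self_eq_norm_sq, div_self h1] at h2)
  have hl := (((t1.add t2).sub (t3.const_mul (1 / 2))).sub (t4.const_mul (1 / 2))).const_mul p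
  have hr := (t5.neg.add (t6.const_mul (((N : ℝ) - α) / 2))).const_mul (rieszConst N α)
  have := tendsto_nhds_unique hl (hr.congr fun n => by
    rw [← hloc _ (cutoff_contDiff N n) (cutoff_hasCompactSupport N n)]
    simp only [mul_comm (cutoff N n _)])
  -- The coefficients combine as `1 - N/2 = -(N-2)/2` for the gradient and `-N + (N-α)/2 = -(N+α)/2`
  -- for the Riesz energy.
  linear_combination -this

theorem mainTheorem3 (N : ℕ) (α p : ℝ) (hα : 0 < α) (hαN : α < N) (hp : 1 < p)
    (u : EuclideanSpace ℝ (Fin N) → ℝ)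
    (hu_W12 : MemW 2 1 u)
    (hu_Lq : MemLp u (ENNReal.ofReal (2 * N * p / (N + α))) volume)
    (hu_sol : IsWeakChoquardSolution α p u)
    (hu_W22loc : MemWLoc 2 2 u)
    (hu_W1q : MemW (ENNReal.ofReal (2 * N * p / (N + α))) 1 u)
    (g : EuclideanSpace ℝ (Fin N) → EuclideanSpace ℝ (Fin N)) (hg : HasWeakGradient u g) :
    Integrable (fun x => ‖g x‖ ^ 2) volume ∧
    Integrable (fun x => |u x| ^ 2) volume ∧
    (∀ᵐ x ∂(volume : Measure (EuclideanSpace ℝ (Fin N))),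
      ConvolutionExistsAt (rieszKernel N α) (fun y => |u y| ^ p) x
        (ContinuousLinearMap.lsmul ℝ ℝ) volume) ∧
    Integrable (fun x => rieszPotential α p u x * |u x| ^ p) volume ∧
    ((N : ℝ) - 2) / 2 * (∫ x, ‖g x‖ ^ 2) + (N : ℝ) / 2 * (∫ x, |u x| ^ 2) =
      ((N : ℝ) + α) / (2 * p) * ∫ x, rieszPotential α p u x * |u x| ^ p := by
  have hNpos : 0 < N := by
    have : (0 : ℝ) < N := by linarith
    exact_mod_cast this
  -- The Sobolev hypotheses provide their own weak derivatives; uniqueness almost everywhere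
  -- transfers their integrability to the given `g`.
  have hg2 : ∀ i, MemLp (fun x => g x i) 2 volume := fun i => by
    obtain ⟨v, hv, hv2⟩ := hu_W12.2 i
    exact (memLp_congr_ae (hv.ae_eq (hg i))).1 hv2
  have hgq : ∀ i, MemLp (fun x => g x i) (ENNReal.ofReal (2 * N * p / (N + α))) volume :=
    fun i => by
      obtain ⟨v, hv, hvq⟩ := hu_W1q.2 i
      exact (memLp_congr_ae (hv.ae_eq (hg i))).1 hvq
  have hW : ∀ j i, ∃ w, HasWeakPartial i (fun x => g x j) w ∧ MemLpLoc 2 w := fun j i => by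
    obtain ⟨v, hv, -, hv2⟩ := hu_W22loc.2 j
    obtain ⟨w, hw, hw2⟩ := hv2 i
    exact ⟨w, hw.congr_left (hv.ae_eq (hg j)), hw2⟩
  choose w hw hwL using hW
  have hsol : ∀ φ : Euc N → ℝ, ContDiff ℝ ∞ φ → HasCompactSupport φ →
      (∫ x, inner ℝ (g x) (gradient φ x)) + ∫ x, u x * φ x =
        ∫ x, rieszPotential α p u x * |u x| ^ (p - 2) * u x * φ x := by
    obtain ⟨g', hg', hs⟩ := hu_sol
    intro φ hφ hc
    rw [← hs φ hφ hc]
    congr 1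
    apply integral_congr_ae
    filter_upwards [ae_all_iff.2 fun i => (hg i).ae_eq (hg' i)] with x hx
    have : g x = g' x := by ext i; exact hx i
    rw [this]
  have hgm : AEStronglyMeasurable g volume := by
    have h1 : AEMeasurable (fun x => (WithLp.ofLp (g x) : Fin N → ℝ)) volume :=
      aemeasurable_pi_lambda _ fun i => (hg2 i).1.aemeasurable
    exact ((PiLp.continuous_toLp 2 fun _ : Fin N => ℝ).measurable.comp_aemeasurable
      h1).aestronglyMeasurable
  have hgi : Integrable (fun x => ‖g x‖ ^ 2) volume := by
    simp_rw [EuclideanSpace.real_norm_sq_eq]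
    exact integrable_finsetSum _ fun i _ => (hg2 i).integrable_sq
  have hui : Integrable (fun x => u x ^ 2) volume := hu_W12.1.integrable_sq
  have hff := memLp_abs_rpow hp hu_Lq
  have hR := integrable_rieszPotential_mul hα hαN hp hu_Lq hff
  have hmain := pohozaev_of_localized (α := α) (p := p) hNpos hgm hui hgi
    (integrable_prod_riesz (by linarith) (by linarith) (riesz_exponent N α) hff hff)
    fun η hη hc => localized_pohozaev hα hαN hp (w := fun j x => WithLp.toLp 2 fun i => w j i x) hg
      hu_W12.1 hg2 hu_Lq hgq (fun j i => hw j i) (fun j i => hwL j i) hsol hη hc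
  simp_rw [sq_abs]
  refine ⟨hgi, hui, ae_convolutionExistsAt_riesz hα hαN hp hu_Lq, hR.1, ?_⟩
  rw [hR.2]
  have hp0 : p ≠ 0 := by linarith
  rw [← mul_right_inj' hp0, hmain]
  field_simp
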